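/- Let $T\ge 0$, let $(\Omega,\mathcal F,P)$ be a probability space and $X=(X_t)_{t\in[0,T]}$ a measurable centered Gaussian process with $X_0=0$ a.s. Let $(\mathcal F^X_t)$ be the filtration generated by $X$ (adaptedness is understood up to null sets), $L^2_X=L^2(\Omega,\mathcal F^X_T,P)$, and let $H_X\subset L^2_X$ be the closed linear span of $\{X_t\}$. For $h\in H_X$ put $\underline h(t)=E[X_th]$ and $e^{\diamond h}=\exp(h-\tfrac12E[h^2])$; the functions $\underline h$, $h\in H_X$, form the Cameron–Martin space $CM_X$, with norm $\|\underline h\|=\|h\|_{L^2}$. For a random variable $V$, square integrable with values in a real Hilbert space, put $(SV)(h)=E[e^{\diamond h}V]$. Let $\mathfrak H_X$ be the Hilbert space completion of the span of the indicators $\mathbf 1_{(0,t]}$, $t\in[0,T]$, under $\langle\mathbf 1_{(0,t]},\mathbf 1_{(0,s]}\rangle=E[X_tX_s]$. A real Hilbert space $\mathcal H$ with elements $\mathbf 1_{(0,t]}$ (the image of the indicators under a linear map from step functions to $\mathcal H$) - satisfies $(I_{\mathcal H})$ if for every $r\in[0,T]$ there is a continuous linear $\mathcal I_r:\mathcal H\to\mathcal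 H$ with $\mathcal I_r\mathbf 1_{(0,t]}=\mathbf 1_{(0,t\wedge r]}$ for all $t$; - is a space of integrands for $\underline c\in CM_X$ if $\{\mathbf 1_{(0,t]}\}$ is total in $\mathcal H$ and $\mathbf 1_{(0,t]}\mapsto\underline c(t)$ extends to a continuous linear functional $\int_0^T\cdot\,d^{\mathcal H}\underline c$ on $\mathcal H$; - is appropriate for $X$ if it is a space of integrands for all $\underline h$ from a dense subset of $CM_X$. $X$ has an indefinite Wiener integral if $\mathfrak H_X$ satisfies $(I_{\mathfrak H_X})$. If $\mathcal H$ is appropriate and $Z\in L^2(\Omega,\mathcal F^X_T,P;\mathcal H)$, then $V\in L^2_X$ is the $\mathcal H$-Skorokhod integral $\int_0^TZ\,d^{\diamond_{\mathcal H}}X$ if $(SV)(h)=\int_0^T(SZ)(h)\,d^{\mathcal H}\underline h$ for every $h\in H_X$ such that $\mathcal H$ is a space of integrands for $\underline h$. Under $(I_{\mathcal H})$, $\int_t^TZ\,d^{\diamond_{\mathcal H}}X$ and $\int_t^TZ\,d^{\mathcal H}\underline c$ are the corresponding integrals over $[0,T]$ of $(\mathcal I_T-\mathcal I_t)Z$.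 Let $\gamma:[0,T]\to\mathbb R$ be continuous of bounded variation with total variation measure $d|\gamma|$, let $a:[0,T]\to\mathbb R$ be measurable, $\underline c\in CM_X$, and $G$ a measurable adapted process with $$\int_0^T|a(s)|\,d|\gamma|(s)+E\Big[\Big(\int_0^T|G_s|\,d|\gamma|(s)\Big)^2\Big]<\infty .$$ For $\xi\in L^2_X$, a mild solution of $$dY_t=(a(t)Y_t+G_t)\,d\gamma(t)+Z\,d\underline c(t)+Z\,d^{\diamond}X_t,\qquad Y_T=\xi,$$ is a triplet $(Y,Z,\mathcal H)$ such that: $\mathcal H$ is appropriate for $X$, satisfies $(I_{\mathcal H})$ and is a space of integrands for $\underline c$; $Y$ is measurable and adapted with $Y_t\in L^2_X$ for all $t$ and $E[(\int_0^T|a(s)Y_s|\,d|\gamma|(s))^2]<\infty$; $Z\in L^2(\Omega,\mathcal F^X_T,P;\mathcal H)$ and $\int_t^TZ\,d^{\diamond_{\mathcal H}}X$ exists for every $t\in[0,T]$; and for every $t\in[0,T]$, almost surely, $$Y_t=\xi-\int_t^T(a(s)Y_s+G_s)\,d\gamma(s)-\int_t^TZ\,d^{\mathcal H}\underline c-\int_t^TZ\,d^{\diamond_{\mathcal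 H}}X .$$ Theorem. Suppose $X$ has an indefinite Wiener integral and is not a martingale with respect to $(\mathcal F^X_t)$. Then for any choice of $a,\gamma,\underline c,G$ as above there is $\xi\in L^2_X$ such that the equation has no mild solution $(Y,Z,\mathcal H)$. -/

import Mathlib

open MeasureTheory ProbabilityTheory
open scoped ENNReal

universe u v

noncomputable section

namespace GaussianBSDE

/-- The compact time interval `[0, T]`. When `0 ≤ T`, its end points are `⊥` and `⊤`. -/
abbrev TimeInterval (T : ℝ) : Type := Set.Icc (0 : ℝ) T

/-- `X` is a (jointly) measurable centered Gaussian process on `[0, T]` with `X_0 = 0`. -/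
structure IsCenteredGaussian {Ω : Type u} {mΩ : MeasurableSpace Ω} {T : ℝ} [Fact (0 ≤ T)]
    (X : TimeInterval T → Ω → ℝ) (P : Measure Ω) : Prop where
  measurable : Measurable fun p : TimeInterval T × Ω => X p.1 p.2
  gaussian : IsGaussianProcess X P
  centered : ∀ t, ∫ ω, X t ω ∂P = 0
  start : X ⊥ =ᵐ[P] 0

section Chaos

variable {Ω : Type u} {mΩ : MeasurableSpace Ω} {T : ℝ} [Fact (0 ≤ T)]
  {X : TimeInterval T → Ω → ℝ} {P : Measure Ω}

theorem IsCenteredGaussian.stronglyMeasurable (hX : IsCenteredGaussian X P) (t : TimeInterval T) :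
    StronglyMeasurable (X t) :=
  (hX.measurable.comp measurable_prodMk_left).stronglyMeasurable

theorem IsCenteredGaussian.memLp (hX : IsCenteredGaussian X P) (t : TimeInterval T) :
    MemLp (X t) 2 P :=
  (hX.gaussian.hasGaussianLaw_eval t).memLp_two

/-- The filtration `(ℱ_t^X)` generated by `X`. -/
def IsCenteredGaussian.filtration (hX : IsCenteredGaussian X P) :
    Filtration (TimeInterval T) mΩ :=
  Filtration.natural X hX.stronglyMeasurable

/-- `V` belongs to `L²(Ω, ℱ_t^X, P; E)`: it is square integrable and agrees almost surely with an
`ℱ_t^X`-measurable variable. For `E = ℝ` and `t = T` this is the space `L²_X`. For a Hilbert space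
`E` and `t = T` this Bochner space is the Hilbert space tensor product `L²_X ⊗ E`. -/
def IsCenteredGaussian.MemL2 (hX : IsCenteredGaussian X P) {E : Type v} [NormedAddCommGroup E]
    (t : TimeInterval T) (V : Ω → E) : Prop :=
  MemLp V 2 P ∧ AEStronglyMeasurable[hX.filtration t] V P

/-- A process is adapted (with respect to the null sets and `(ℱ_t^X)`) if its value at each time `t`
agrees almost surely with an `ℱ_t^X`-measurable variable. -/
def IsCenteredGaussian.IsAdapted (hX : IsCenteredGaussian X P)
    (Y : TimeInterval T → Ω → ℝ) : Prop :=
  ∀ t, AEStronglyMeasurable[hX.filtration t] (Y t) P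

/-! ### First chaos, Cameron-Martin space, `S`-transform -/

/-- The first chaos `H_X`: the closed linear span of `{X_s : s ∈ [0, T]}` in `L²`. -/
def firstChaos (X : TimeInterval T → Ω → ℝ) (P : Measure Ω) : Submodule ℝ (Lp ℝ 2 P) :=
  (Submodule.span ℝ {f : Lp ℝ 2 P | ∃ t, f =ᵐ[P] X t}).topologicalClosure

/-- The Cameron-Martin function `t ↦ E[X_t h]` associated with `h`. -/
def cameronMartinFun (X : TimeInterval T → Ω → ℝ) (P : Measure Ω) (h : Lp ℝ 2 P)
    (t : TimeInterval T) : ℝ :=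
  ∫ ω, X t ω * h ω ∂P

/-- The (underlying set of the) Cameron-Martin space of `X`. -/
def cameronMartin (X : TimeInterval T → Ω → ℝ) (P : Measure Ω) : Set (TimeInterval T → ℝ) :=
  cameronMartinFun X P '' (firstChaos X P : Set (Lp ℝ 2 P))

/-- The Wick exponential `exp(h - E[h²]/2)`. -/
def wickExp (P : Measure Ω) (h : Lp ℝ 2 P) (ω : Ω) : ℝ :=
  Real.exp (h ω - (1 / 2) * ∫ ω', h ω' ^ 2 ∂P)

/-- The `S`-transform `E[exp(h - E[h²]/2) V]` of a real or Hilbert space valued variable `V`,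
evaluated at an element `h` of the first chaos (that is, at the deterministic integrand whose Wiener
integral is `h`). For `V ∈ L²_X ⊗ E` it is the element of `E` obtained by pairing the
`L²_X`-coordinate of `V` with the Wick exponential. -/
def sTransform (P : Measure Ω) {E : Type v} [NormedAddCommGroup E] [NormedSpace ℝ E]
    (V : Ω → E) (h : Lp ℝ 2 P) : E :=
  ∫ ω, wickExp P h ω • V ω ∂P

/-! ### The space of deterministic integrands of `X` -/

/-- Formal linear combinations of the indicators `1_{(0,t]}`, `t ∈ [0, T]`: the function `f` stands
for `∑ f(t) 1_{(0,t]}`. -/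
def FormalStep (_hX : IsCenteredGaussian X P) : Type := TimeInterval T →₀ ℝ

instance (hX : IsCenteredGaussian X P) : AddCommGroup (FormalStep hX) :=
  inferInstanceAs (AddCommGroup (TimeInterval T →₀ ℝ))

instance (hX : IsCenteredGaussian X P) : Module ℝ (FormalStep hX) :=
  inferInstanceAs (Module ℝ (TimeInterval T →₀ ℝ))

/-- A formal linear combination, viewed as a finitely supported function. -/
def FormalStep.toFinsupp (hX : IsCenteredGaussian X P) :
    FormalStep hX ≃ₗ[ℝ] (TimeInterval T →₀ ℝ) :=
  LinearEquiv.refl ℝ (TimeInterval T →₀ ℝ)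

/-- The formal linear combination consisting of the single indicator `1_{(0,t]}`. -/
def formalIndicator (hX : IsCenteredGaussian X P) (t : TimeInterval T) : FormalStep hX :=
  (FormalStep.toFinsupp hX).symm (Finsupp.single t 1)

/-- The linear map with `1_{(0,t]} ↦ X_t`. -/
def elementaryIntegral (hX : IsCenteredGaussian X P) : FormalStep hX →ₗ[ℝ] Lp ℝ 2 P :=
  (Finsupp.linearCombination ℝ fun t : TimeInterval T => (hX.memLp t).toLp (X t)) ∘ₗ
    (FormalStep.toFinsupp hX).toLinearMap

/-- The semi-inner product on step functions determined by `⟨1_{(0,t]}, 1_{(0,s]}⟩ = E[X_t X_s]`. -/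
@[reducible] def stepCore (hX : IsCenteredGaussian X P) : PreInnerProductSpace.Core ℝ (FormalStep hX) where
  inner f g := inner ℝ (elementaryIntegral hX f) (elementaryIntegral hX g)
  conj_inner_symm f g := inner_conj_symm (𝕜 := ℝ) _ _
  re_inner_nonneg f := inner_self_nonneg (𝕜 := ℝ)
  add_left f g k := by rw [map_add, inner_add_left]
  smul_left f g r := by rw [map_smul, inner_smul_left]

instance (hX : IsCenteredGaussian X P) : SeminormedAddCommGroup (FormalStep hX) :=
  @InnerProductSpace.Core.toSeminormedAddCommGroup ℝ (FormalStep hX) _ _ _ (stepCore hX)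

instance (hX : IsCenteredGaussian X P) : InnerProductSpace ℝ (FormalStep hX) :=
  InnerProductSpace.ofCore (stepCore hX)

theorem inner_formalIndicator (hX : IsCenteredGaussian X P) (t s : TimeInterval T) :
    inner ℝ (formalIndicator hX t) (formalIndicator hX s) = ∫ ω, X t ω * X s ω ∂P := by
  have h : ∀ r, elementaryIntegral hX (formalIndicator hX r) = (hX.memLp r).toLp (X r) := fun r => by
    simp [elementaryIntegral, formalIndicator, Finsupp.linearCombination_single]
  change inner ℝ (elementaryIntegral hX (formalIndicator hX t))
    (elementaryIntegral hX (formalIndicator hX s)) = _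
  rw [h, h, L2.inner_def]
  refine integral_congr_ae ?_
  filter_upwards [(hX.memLp t).coeFn_toLp, (hX.memLp s).coeFn_toLp] with ω h1 h2
  rw [h1, h2]
  simp [mul_comm]

/-- The space of deterministic integrands of `X`: the Hilbert space completion of the linear span of
the indicators `1_{(0,t]}` with respect to `⟨1_{(0,t]}, 1_{(0,s]}⟩ = E[X_t X_s]`. -/
abbrev DetIntegrands (hX : IsCenteredGaussian X P) : Type := UniformSpace.Completion (FormalStep hX)

/-- The element `1_{(0,t]}` of the space of deterministic integrands. -/
def detIndicator (hX : IsCenteredGaussian X P) (t : TimeInterval T) : DetIntegrands hX :=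
  (formalIndicator hX t : DetIntegrands hX)

end Chaos

/-! ### Spaces of integrands

A Hilbert space `H` containing the indicators `1_{(0,t]}` is given by the map `ι : t ↦ 1_{(0,t]}`
from `[0, T]` into `H`. Since the indicators `1_{(0,t]}`, `0 < t ≤ T`, are linearly independent
functions and `1_{(0,0]} = 0`, such a map is the same as a linear map from step functions into `H`
if and only if it vanishes at `0`. -/

section Integrands

variable {Ω : Type u} {mΩ : MeasurableSpace Ω} {T : ℝ} [Fact (0 ≤ T)]
  {X : TimeInterval T → Ω → ℝ} {P : Measure Ω}
  {H : Type v} [NormedAddCommGroup H] [InnerProductSpace ℝ H]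

/-- The family `𝓘` realises the condition `(I_H)`: each `𝓘 r` is a continuous linear operator with
`1_{(0,t]} ↦ 1_{(0, t ∧ r]}`. -/
def IsTruncation (ι : TimeInterval T → H) (𝓘 : TimeInterval T → H →L[ℝ] H) : Prop :=
  ∀ r t, 𝓘 r (ι t) = ι (min t r)

/-- `X` has an indefinite Wiener integral: its space of deterministic integrands satisfies
the condition `(I_H)`. -/
def HasIndefiniteWienerIntegral (hX : IsCenteredGaussian X P) : Prop :=
  ∃ 𝓘 : TimeInterval T → DetIntegrands hX →L[ℝ] DetIntegrands hX, IsTruncation (detIndicator hX) 𝓘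

/-- The continuous linear functional `L` is the integral `∫_0^T · d^H c`. -/
def IsIntegral (ι : TimeInterval T → H) (c : TimeInterval T → ℝ) (L : H →L[ℝ] ℝ) : Prop :=
  ∀ t, L (ι t) = c t

/-- `H` is a space of integrands for the integrator `c`. -/
structure IsSpaceOfIntegrands (ι : TimeInterval T → H) (c : TimeInterval T → ℝ) : Prop where
  zero : ι ⊥ = 0
  total : Dense (Submodule.span ℝ (Set.range ι) : Set H)
  functional : ∃ L : H →L[ℝ] ℝ, IsIntegral ι c L

/-- `H` is appropriate for `X`: it is a space of integrands for the integrators from a dense subset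
of the Cameron-Martin space, which carries the norm of the first chaos. -/
def IsAppropriate (X : TimeInterval T → Ω → ℝ) (P : Measure Ω) (ι : TimeInterval T → H) : Prop :=
  Dense {h : firstChaos X P | IsSpaceOfIntegrands ι (cameronMartinFun X P h)}

/-- `V ∈ L²_X` is the `H`-Skorokhod integral `∫_0^T Z d^⋄X` of `Z ∈ L²(Ω, H)`: for all `h` such that
`H` is a space of integrands for the Cameron-Martin function of `h`, the `S`-transform of `V` at `h`
is the integral of the `S`-transform of `Z` at `h` against this function. -/
def IsSkorokhodIntegral (hX : IsCenteredGaussian X P) (ι : TimeInterval T → H)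
    (Z : Ω → H) (V : Ω → ℝ) : Prop :=
  hX.MemL2 ⊤ V ∧ ∀ h ∈ firstChaos X P, ∀ L : H →L[ℝ] ℝ, IsIntegral ι (cameronMartinFun X P h) L →
    sTransform P V h = L (sTransform P Z h)

end Integrands

/-! ### Integration with respect to a function of bounded variation -/

section Stieltjes

variable {T : ℝ} {γ : TimeInterval T → ℝ}

instance : CompactIccSpace (TimeInterval T) := ⟨fun {_ _} => isClosed_Icc.isCompact⟩

/-- The signed Lebesgue-Stieltjes measure `dγ` on `[0, T]`. -/
def stieltjes (hγ : BoundedVariationOn γ Set.univ) : SignedMeasure (TimeInterval T) :=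
  hγ.vectorMeasure

/-- The total variation measure `d|γ|` on `[0, T]`. -/
def totalVar (hγ : BoundedVariationOn γ Set.univ) : Measure (TimeInterval T) :=
  (stieltjes hγ).totalVariation

/-- The Lebesgue-Stieltjes integral `∫_B f dγ`. -/
def stieltjesIntegral (hγ : BoundedVariationOn γ Set.univ) (B : Set (TimeInterval T))
    (f : TimeInterval T → ℝ) : ℝ :=
  (∫ s in B, f s ∂(stieltjes hγ).toJordanDecomposition.posPart) -
    ∫ s in B, f s ∂(stieltjes hγ).toJordanDecomposition.negPart

end Stieltjes

/-! ### The linear BSDE -/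

section BSDE

variable {Ω : Type u} {mΩ : MeasurableSpace Ω} {T : ℝ} [Fact (0 ≤ T)]
  {X : TimeInterval T → Ω → ℝ} {P : Measure Ω} {γ : TimeInterval T → ℝ}

/-- The standing assumptions on the coefficients of the BSDE, for `γ` of bounded variation. -/
structure IsAdmissible (hX : IsCenteredGaussian X P) (hγ : BoundedVariationOn γ Set.univ)
    (a c : TimeInterval T → ℝ) (G : TimeInterval T → Ω → ℝ) : Prop where
  continuous_γ : Continuous γ
  mem_cameronMartin : c ∈ cameronMartin X P
  measurable_a : Measurable a
  measurable_G : Measurable fun p : TimeInterval T × Ω => G p.1 p.2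
  adapted_G : hX.IsAdapted G
  integrable_a : ∫⁻ s, ‖a s‖ₑ ∂totalVar hγ < ∞
  integrable_G : ∫⁻ ω, (∫⁻ s, ‖G s ω‖ₑ ∂totalVar hγ) ^ 2 ∂P < ∞

/-- `(Y, Z, H)` is a mild solution, with terminal value `ξ`, of the linear BSDE
`dY = (a Y + G) dγ + Z dc + Z d^⋄X`, `Y_T = ξ`. Here `H` is a Hilbert space with indicators `ι`. -/
structure IsMildSolution (hX : IsCenteredGaussian X P) (hγ : BoundedVariationOn γ Set.univ)
    (a c : TimeInterval T → ℝ) (G : TimeInterval T → Ω → ℝ) (ξ : Ω → ℝ)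
    {H : Type v} [NormedAddCommGroup H] [InnerProductSpace ℝ H] [CompleteSpace H]
    (ι : TimeInterval T → H) (Y : TimeInterval T → Ω → ℝ) (Z : Ω → H) : Prop where
  appropriate : IsAppropriate X P ι
  integrands : IsSpaceOfIntegrands ι c
  measurable_Y : Measurable fun p : TimeInterval T × Ω => Y p.1 p.2
  adapted_Y : hX.IsAdapted Y
  memL2_Y : ∀ t, hX.MemL2 ⊤ (Y t)
  integrable_Y : ∫⁻ ω, (∫⁻ s, ‖a s * Y s ω‖ₑ ∂totalVar hγ) ^ 2 ∂P < ∞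
  memL2_Z : hX.MemL2 ⊤ Z
  /-- `(I_H)` holds, `V t = ∫_t^T Z d^⋄X` exists for all `t`, and the integral equation holds, with
  `L = ∫_0^T · d^H c`. Both integrals over `(t, T]` are integrals over `[0, T]` of the image of `Z`
  under `𝓘_T - 𝓘_t`. -/
  equation : ∃ (𝓘 : TimeInterval T → H →L[ℝ] H) (L : H →L[ℝ] ℝ) (V : TimeInterval T → Ω → ℝ),
    IsTruncation ι 𝓘 ∧ IsIntegral ι c L ∧
    (∀ t, IsSkorokhodIntegral hX ι (fun ω => (𝓘 ⊤ - 𝓘 t) (Z ω)) (V t)) ∧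
    ∀ t, Y t =ᵐ[P] fun ω => ξ ω
      - stieltjesIntegral hγ (Set.Ioc t ⊤) (fun s => a s * Y s ω + G s ω)
      - L ((𝓘 ⊤ - 𝓘 t) (Z ω)) - V t ω

end BSDE

end GaussianBSDE

end

open GaussianBSDE

/-! Suppose every terminal value admits a mild solution; then `X` must be a martingale. Fix `t`. The
adjoint of the truncation at `t`, transported by the Wiener integral, is a bounded operator `B` on
the first chaos that freezes Cameron–Martin functions at time `t` (`exists_stopping`). Take
S-transforms of the equation at `B k - c₀`, where `c₀` represents `c`. The shift by `c₀` absorbs the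
drift `Z dc`, and what remains is integration against a function constant after `t`; hence the two
`Z`-integrals over `(s, T]`, `s ≥ t`, cancel (`sTransform_integrals_eq_zero`).

This leaves a deterministic linear equation on `[t, T]`. Subtracting the solution with terminal
value `0` removes `G`, and Grönwall bounds the S-transform of `ξ` by those of the two solutions at
time `t`. Those variables are `ℱ_t`-measurable, so their transforms do not distinguish `B k` from
`k`. Therefore the S-transform of `ξ` at `B k - c₀` is `O(exp(‖k - c₀‖²/2))`
(`exists_bound_of_isMildSolution`).

As a functional of `ξ`, however, this S-transform has norm `exp(‖B k - c₀‖²/2)`. Uniform boundedness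
over all `ξ` bounds `‖B k - c₀‖² - ‖k - c₀‖²`, and scaling `k` gives `‖B k‖ ≤ ‖k‖`
(`IsCenteredGaussian.contractive_of_sTransform_bound`). The adjoint of `B` fixes `X_s` for `s ≤ t`
and kills `X_u - X_t` for `u ≥ t`; if it is a contraction, the increments are orthogonal to, hence
independent of, the past (`martingale_of_stopping_contractive`). -/

namespace GaussianBSDE

open Filter Topology

/-! ### Centered Gaussian elements of `L²`. -/

section GaussianL2

variable {Ω : Type u} {mΩ : MeasurableSpace Ω} {P : Measure Ω}

theorem norm_sq_eq_integral (h : Lp ℝ 2 P) : ‖h‖ ^ 2 = ∫ ω, h ω ^ 2 ∂P := by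
  rw [← real_inner_self_eq_norm_sq, L2.inner_def]
  exact integral_congr_ae (.of_forall fun ω => by simp [sq])

theorem inner_eq_integral_mul (f g : Lp ℝ 2 P) : inner ℝ f g = ∫ ω, f ω * g ω ∂P := by
  rw [L2.inner_def]
  exact integral_congr_ae (.of_forall fun ω => by simp [mul_comm])

/-- The set of centered Gaussian elements of `L²` is closed. -/
theorem isClosed_centeredGaussian [IsProbabilityMeasure P] :
    IsClosed {h : Lp ℝ 2 P | P.map h = gaussianReal 0 (‖h‖₊ ^ 2)} := by
  refine IsSeqClosed.isClosed fun f h hf hfh => ?_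
  -- Along an a.e. convergent subsequence the characteristic functions converge by domination by
  -- `1`, while the variances converge with the norms; the two limits agree.
  obtain ⟨ns, hns, hae⟩ := (tendstoInMeasure_of_tendsto_Lp hfh).exists_seq_tendsto_ae
  have meas (g : Lp ℝ 2 P) : AEMeasurable g P := (Lp.aestronglyMeasurable g).aemeasurable
  have := Measure.isProbabilityMeasure_map (meas h)
  refine Measure.ext_of_charFun (funext fun t => ?_)
  have key (g : Lp ℝ 2 P) : charFun (P.map g) t = ∫ ω, Complex.exp (t * g ω * Complex.I) ∂P := by
    rw [charFun_apply_real, integral_map (meas g) (by fun_prop)]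
  have lim1 : Tendsto (fun n => charFun (P.map (f (ns n))) t) atTop (𝓝 (charFun (P.map h) t)) := by
    simp_rw [key]
    refine tendsto_integral_of_dominated_convergence (fun _ => 1) (fun n => ?_)
      (integrable_const _) (fun n => .of_forall fun ω => ?_) ?_
    · have := meas (f (ns n))
      exact AEMeasurable.aestronglyMeasurable (by fun_prop)
    · rw [← Complex.ofReal_mul, Complex.norm_exp_ofReal_mul_I]
    · filter_upwards [hae] with ω hω
      exact ((Complex.continuous_exp.comp ((continuous_const.mul
        Complex.continuous_ofReal).mul continuous_const)).tendsto (h ω)).comp hω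
  have lim2 : Tendsto (fun n => charFun (P.map (f (ns n))) t) atTop
      (𝓝 (charFun (gaussianReal 0 (‖h‖₊ ^ 2)) t)) := by
    have : ∀ n, charFun (P.map (f (ns n))) t = charFun (gaussianReal 0 (‖f (ns n)‖₊ ^ 2)) t :=
      fun n => by rw [show P.map (f (ns n)) = _ from hf (ns n)]
    simp_rw [this, charFun_gaussianReal]
    have hc : Continuous fun g : Lp ℝ 2 P =>
        Complex.exp (t * (0 : ℝ) * Complex.I - ((‖g‖₊ ^ 2 : NNReal) : ℝ) * t ^ 2 / 2) := by
      push_cast; fun_prop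
    exact (hc.tendsto h).comp (hfh.comp hns.tendsto_atTop)
  exact tendsto_nhds_unique lim1 lim2

/-- A centered Gaussian variable, seen in `L²`, has variance given by its norm. -/
theorem map_eq_gaussianReal_of_hasGaussianLaw {h : Lp ℝ 2 P} (hG : HasGaussianLaw h P)
    (h0 : ∫ ω, h ω ∂P = 0) : P.map h = gaussianReal 0 (‖h‖₊ ^ 2) := by
  rw [hG.map_eq_gaussianReal, h0, variance_of_integral_eq_zero hG.aemeasurable h0,
    ← norm_sq_eq_integral]
  congr 1
  ext
  simp

end GaussianL2

/-! ### The first chaos: Gaussianity, and independence from the past. -/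

section Chaos

variable {Ω : Type u} {mΩ : MeasurableSpace Ω} {T : ℝ} [Fact (0 ≤ T)]
  {X : TimeInterval T → Ω → ℝ} {P : Measure Ω}

/-- The value `X_t` as an element of `L²`. -/
noncomputable def IsCenteredGaussian.val (hX : IsCenteredGaussian X P) (t : TimeInterval T) :
    Lp ℝ 2 P :=
  (hX.memLp t).toLp (X t)

theorem IsCenteredGaussian.coeFn_val (hX : IsCenteredGaussian X P) (t : TimeInterval T) :
    hX.val t =ᵐ[P] X t :=
  (hX.memLp t).coeFn_toLp

/-- The closed linear span in `L²` of the values of the process up to time `t`. -/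
noncomputable def IsCenteredGaussian.past (hX : IsCenteredGaussian X P) (t : TimeInterval T) :
    Submodule ℝ (Lp ℝ 2 P) :=
  (Submodule.span ℝ (hX.val '' Set.Iic t)).topologicalClosure

theorem IsCenteredGaussian.firstChaos_eq (hX : IsCenteredGaussian X P) :
    firstChaos X P = (Submodule.span ℝ (Set.range hX.val)).topologicalClosure := by
  have : {f : Lp ℝ 2 P | ∃ t, f =ᵐ[P] X t} = Set.range hX.val := by
    ext f
    refine exists_congr fun t => ⟨fun h => Lp.ext ((hX.coeFn_val t).trans h.symm), ?_⟩
    rintro rfl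
    exact hX.coeFn_val t
  rw [firstChaos, this]

theorem IsCenteredGaussian.val_mem_firstChaos (hX : IsCenteredGaussian X P) (t : TimeInterval T) :
    hX.val t ∈ firstChaos X P := by
  rw [hX.firstChaos_eq]
  exact Submodule.le_topologicalClosure _ (Submodule.subset_span ⟨t, rfl⟩)

theorem IsCenteredGaussian.val_mem_past (hX : IsCenteredGaussian X P) {s t : TimeInterval T}
    (hst : s ≤ t) : hX.val s ∈ hX.past t :=
  Submodule.le_topologicalClosure _ (Submodule.subset_span ⟨s, hst, rfl⟩)

theorem IsCenteredGaussian.past_le_firstChaos (hX : IsCenteredGaussian X P) (t : TimeInterval T) :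
    hX.past t ≤ firstChaos X P := by
  rw [hX.firstChaos_eq]
  exact Submodule.topologicalClosure_mono (Submodule.span_mono (Set.image_subset_range _ _))

theorem IsCenteredGaussian.firstChaos_eq_past (hX : IsCenteredGaussian X P) :
    firstChaos X P = hX.past ⊤ := by
  rw [hX.firstChaos_eq, past, Set.Iic_top, Set.image_univ]

omit [Fact (0 ≤ T)] in
theorem isClosed_firstChaos : IsClosed (firstChaos X P : Set (Lp ℝ 2 P)) :=
  Submodule.isClosed_topologicalClosure _

/-- Vectors orthogonal to the values of the process up to time `t` are orthogonal to their closed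
linear span. -/
theorem IsCenteredGaussian.mem_past_orthogonal (hX : IsCenteredGaussian X P) {t : TimeInterval T}
    {h : Lp ℝ 2 P} (H : ∀ s ≤ t, inner ℝ (hX.val s) h = 0) : h ∈ (hX.past t)ᗮ := by
  rw [past, Submodule.orthogonal_closure]
  refine (Submodule.mem_orthogonal _ _).2 fun f hf => ?_
  induction hf using Submodule.span_induction with
  | mem f hf => obtain ⟨s, hs, rfl⟩ := hf; exact H s hs
  | zero => simp
  | add f g _ _ hf hg => rw [inner_add_left, hf, hg, add_zero]
  | smul c f _ hf => rw [inner_smul_left, hf, mul_zero]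

theorem IsCenteredGaussian.cameronMartinFun_eq (hX : IsCenteredGaussian X P) (h : Lp ℝ 2 P)
    (t : TimeInterval T) : cameronMartinFun X P h t = inner ℝ (hX.val t) h := by
  rw [inner_eq_integral_mul, cameronMartinFun]
  refine integral_congr_ae ?_
  filter_upwards [hX.coeFn_val t] with ω hω
  rw [hω]

/-- Elements of the first chaos are centered Gaussian variables. -/
theorem IsCenteredGaussian.map_eq_gaussianReal (hX : IsCenteredGaussian X P) {h : Lp ℝ 2 P}
    (hh : h ∈ firstChaos X P) : P.map h = gaussianReal 0 (‖h‖₊ ^ 2) := by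
  have := hX.gaussian.isProbabilityMeasure
  rw [hX.firstChaos_eq] at hh
  refine closure_minimal (fun f hf => ?_) isClosed_centeredGaussian hh
  obtain ⟨c, rfl⟩ := Finsupp.mem_span_range_iff_exists_finsupp.1 hf
  have hc : (c.sum fun i a => a • hX.val i : Lp ℝ 2 P)
      =ᵐ[P] fun ω => ∑ i ∈ c.support, c i • X i ω := by
    refine (Lp.coeFn_finsetSum _ _).trans ?_
    have : ∀ᵐ ω ∂P, ∀ i ∈ c.support, (c i • hX.val i : Lp ℝ 2 P) ω = c i • X i ω := by
      rw [c.support.eventually_all]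
      intro i _
      filter_upwards [Lp.coeFn_smul (c i) (hX.val i), hX.coeFn_val i] with ω h1 h2
      rw [h1, Pi.smul_apply, h2]
    filter_upwards [this] with ω hω
    rw [Finset.sum_apply]
    exact Finset.sum_congr rfl hω
  refine map_eq_gaussianReal_of_hasGaussianLaw
    (((hX.gaussian.smul c).hasGaussianLaw_fun_sum (I := c.support)).congr hc.symm) ?_
  rw [integral_congr_ae hc, integral_finsetSum]
  · simp [integral_const_mul, hX.centered]
  · exact fun i _ => ((hX.gaussian.hasGaussianLaw_eval i).integrable).smul (c i)

theorem IsCenteredGaussian.integral_eq_zero (hX : IsCenteredGaussian X P) {h : Lp ℝ 2 P}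
    (hh : h ∈ firstChaos X P) : ∫ ω, h ω ∂P = 0 := by
  have := integral_map (Lp.aestronglyMeasurable h).aemeasurable
    (f := fun x : ℝ => x) (by fun_prop)
  rw [← this, hX.map_eq_gaussianReal hh]
  simp

/-- The first chaos is a Gaussian process indexed by itself. -/
theorem IsCenteredGaussian.isGaussianProcess_firstChaos (hX : IsCenteredGaussian X P) :
    IsGaussianProcess (fun (h : firstChaos X P) ω => (h : Lp ℝ 2 P) ω) P := by
  refine ⟨fun I => ⟨isGaussian_of_map_eq_gaussianReal fun L => ?_⟩⟩
  have meas (g : Lp ℝ 2 P) : AEMeasurable g P := (Lp.aestronglyMeasurable g).aemeasurable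
  classical
  -- A linear functional of finitely many chaos elements is again a chaos element, so its law is
  -- already known to be Gaussian.
  let g : firstChaos X P := ∑ i : I, L (Pi.single i 1) • (i : firstChaos X P)
  refine ⟨0, ‖(g : Lp ℝ 2 P)‖₊ ^ 2, ?_⟩
  rw [← hX.map_eq_gaussianReal g.2, AEMeasurable.map_map_of_aemeasurable
    (f := fun ω => I.restrict fun x : firstChaos X P => (x : Lp ℝ 2 P) ω)
    (L.continuous.aemeasurable) (aemeasurable_pi_lambda _ fun i => meas _)]
  refine Measure.map_congr ?_
  have hg : (g : Lp ℝ 2 P) = ∑ i : I, L (Pi.single i 1) • ((i : firstChaos X P) : Lp ℝ 2 P) := by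
    simp [g]
  rw [hg]
  refine EventuallyEq.trans ?_ (Lp.coeFn_finsetSum _ _).symm
  have : ∀ᵐ ω ∂P, ∀ i : I, (L (Pi.single i 1) • ((i : firstChaos X P) : Lp ℝ 2 P) : Lp ℝ 2 P) ω
      = L (Pi.single i 1) * ((i : firstChaos X P) : Lp ℝ 2 P) ω := by
    rw [eventually_all]
    intro i
    filter_upwards [Lp.coeFn_smul (L (Pi.single i 1)) ((i : firstChaos X P) : Lp ℝ 2 P)] with ω h
    rw [h, Pi.smul_apply, smul_eq_mul]
  filter_upwards [this] with ω hω
  rw [Finset.sum_apply, Finset.sum_congr rfl fun i _ => hω i, Function.comp_apply]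
  conv_lhs => rw [← L.coe_coe, LinearMap.pi_apply_eq_sum_univ]
  refine Finset.sum_congr rfl fun i _ => ?_
  have hi : (Pi.single i 1 : I → ℝ) = fun j => if i = j then 1 else 0 := by
    ext j
    simp [Pi.single_apply, eq_comm]
  rw [smul_eq_mul, mul_comm, hi]
  rfl

/-- An element of the first chaos orthogonal to the past is independent of the past. -/
theorem IsCenteredGaussian.indep_filtration (hX : IsCenteredGaussian X P) {t : TimeInterval T}
    {h : Lp ℝ 2 P} (hh : h ∈ firstChaos X P) (H : ∀ s ≤ t, inner ℝ (hX.val s) h = 0) :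
    Indep (MeasurableSpace.comap h inferInstance) (hX.filtration t) P := by
  have := hX.gaussian.isProbabilityMeasure
  -- Joint Gaussianity of the past and `h` upgrades orthogonality to independence.
  have hG : IsGaussianProcess
      (Sum.elim (fun s : Set.Iic t => X s) (fun _ : Unit => (h : Ω → ℝ))) P := by
    refine (hX.isGaussianProcess_firstChaos.comp_right
      (Sum.elim (fun s : Set.Iic t => ⟨hX.val s, hX.val_mem_firstChaos s⟩)
        (fun _ : Unit => ⟨h, hh⟩))).congr ?_
    rintro (s | s)
    · exact hX.coeFn_val s
    · exact .rfl
  have ind := hG.indepFun_of_covariance_eq_zero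
    (fun s => (hX.stronglyMeasurable s).measurable.aemeasurable)
    (fun _ => (Lp.aestronglyMeasurable h).aemeasurable) (fun s _ => by
      rw [covariance_eq_sub (hX.memLp s) (Lp.memLp h), hX.centered, zero_mul, sub_zero]
      exact (hX.cameronMartinFun_eq h s).trans (H s s.2))
  rw [IsCenteredGaussian.filtration, Filtration.natural_eq_comap]
  have hev : Measurable fun f : Unit → ℝ => f () := measurable_pi_apply ()
  have ind2 := ind.comp measurable_id hev
  exact Indep.symm ind2

theorem IsCenteredGaussian.aestronglyMeasurable_of_mem_past (hX : IsCenteredGaussian X P)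
    {t : TimeInterval T} {h : Lp ℝ 2 P} (hh : h ∈ hX.past t) :
    AEStronglyMeasurable[hX.filtration t] h P := by
  refine closure_minimal (t := {f : Lp ℝ 2 P | AEStronglyMeasurable[hX.filtration t] f P}) ?_
    (isClosed_aestronglyMeasurable (hX.filtration.le t)) hh
  have : Submodule.span ℝ (hX.val '' Set.Iic t) ≤ lpMeas ℝ ℝ (hX.filtration t) 2 P := by
    rw [Submodule.span_le]
    rintro _ ⟨s, hs, rfl⟩
    have hm : StronglyMeasurable[hX.filtration t] (X s) :=
      ((Filtration.stronglyAdapted_natural hX.stronglyMeasurable) s).mono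
        (hX.filtration.mono hs)
    exact mem_lpMeas_iff_aestronglyMeasurable.2
      (hm.aestronglyMeasurable.congr (hX.coeFn_val s).symm)
  exact fun f hf => mem_lpMeas_iff_aestronglyMeasurable.1 (this hf)

end Chaos

/-! ### Wick exponentials and the S-transform. -/

section Wick

variable {Ω : Type u} {mΩ : MeasurableSpace Ω} {T : ℝ} [Fact (0 ≤ T)]
  {X : TimeInterval T → Ω → ℝ} {P : Measure Ω}

theorem wickExp_eq (h : Lp ℝ 2 P) (ω : Ω) : wickExp P h ω = Real.exp (h ω - ‖h‖ ^ 2 / 2) := by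
  rw [wickExp, ← norm_sq_eq_integral]
  ring_nf

theorem wickExp_add (f h : Lp ℝ 2 P) :
    (fun ω => wickExp P f ω * wickExp P h ω)
      =ᵐ[P] fun ω => Real.exp (inner ℝ f h) * wickExp P (f + h) ω := by
  filter_upwards [Lp.coeFn_add f h] with ω hω
  rw [wickExp_eq, wickExp_eq, wickExp_eq, ← Real.exp_add, ← Real.exp_add, hω, Pi.add_apply,
    norm_add_sq_real]
  ring_nf

theorem IsCenteredGaussian.integrable_exp (hX : IsCenteredGaussian X P) {h : Lp ℝ 2 P}
    (hh : h ∈ firstChaos X P) : Integrable (fun ω => Real.exp (h ω)) P := by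
  have := integrable_exp_mul_gaussianReal (μ := 0) (v := ‖h‖₊ ^ 2) 1
  rw [← hX.map_eq_gaussianReal hh,
    integrable_map_measure (by fun_prop) (Lp.aestronglyMeasurable h).aemeasurable] at this
  simpa [Function.comp_def] using this

theorem IsCenteredGaussian.integral_exp (hX : IsCenteredGaussian X P) {h : Lp ℝ 2 P}
    (hh : h ∈ firstChaos X P) : ∫ ω, Real.exp (h ω) ∂P = Real.exp (‖h‖ ^ 2 / 2) := by
  have := mgf_gaussianReal (hX.map_eq_gaussianReal hh) 1
  simpa [mgf] using this

theorem IsCenteredGaussian.integrable_wickExp (hX : IsCenteredGaussian X P) {h : Lp ℝ 2 P}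
    (hh : h ∈ firstChaos X P) : Integrable (wickExp P h) P := by
  have : wickExp P h = fun ω => Real.exp (h ω) * Real.exp (-(‖h‖ ^ 2 / 2)) := by
    ext ω
    rw [wickExp_eq, ← Real.exp_add, sub_eq_add_neg]
  rw [this]
  exact (hX.integrable_exp hh).mul_const _

theorem IsCenteredGaussian.integral_wickExp (hX : IsCenteredGaussian X P) {h : Lp ℝ 2 P}
    (hh : h ∈ firstChaos X P) : ∫ ω, wickExp P h ω ∂P = 1 := by
  simp_rw [wickExp_eq, sub_eq_add_neg, Real.exp_add, integral_mul_const, hX.integral_exp hh]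
  rw [← Real.exp_add, add_neg_cancel, Real.exp_zero]

theorem IsCenteredGaussian.integral_wickExp_mul (hX : IsCenteredGaussian X P) {f h : Lp ℝ 2 P}
    (hf : f ∈ firstChaos X P) (hh : h ∈ firstChaos X P) :
    ∫ ω, wickExp P f ω * wickExp P h ω ∂P = Real.exp (inner ℝ f h) := by
  rw [integral_congr_ae (wickExp_add f h), integral_const_mul,
    hX.integral_wickExp (add_mem hf hh), mul_one]

theorem aestronglyMeasurable_wickExp (h : Lp ℝ 2 P) {m : MeasurableSpace Ω}
    (hh : AEStronglyMeasurable[m] h P) : AEStronglyMeasurable[m] (wickExp P h) P := by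
  have : Continuous fun x : ℝ => Real.exp (x - ‖h‖ ^ 2 / 2) := by fun_prop
  exact (this.comp_aestronglyMeasurable hh).congr (.of_forall fun ω => (wickExp_eq h ω).symm)

theorem IsCenteredGaussian.memLp_wickExp (hX : IsCenteredGaussian X P) {h : Lp ℝ 2 P}
    (hh : h ∈ firstChaos X P) : MemLp (wickExp P h) 2 P := by
  refine (memLp_two_iff_integrable_sq
    (aestronglyMeasurable_wickExp h (Lp.aestronglyMeasurable h))).2 ?_
  refine (((hX.integrable_wickExp (add_mem hh hh)).const_mul _).congr
    (wickExp_add h h).symm).congr (.of_forall fun ω => (sq _).symm)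

/-- The Wick exponential as a map from the first chaos to `L²`. -/
noncomputable def IsCenteredGaussian.wick (hX : IsCenteredGaussian X P) (h : firstChaos X P) :
    Lp ℝ 2 P :=
  (hX.memLp_wickExp h.2).toLp (wickExp P h)

theorem IsCenteredGaussian.coeFn_wick (hX : IsCenteredGaussian X P) (h : firstChaos X P) :
    hX.wick h =ᵐ[P] wickExp P h :=
  (hX.memLp_wickExp h.2).coeFn_toLp

theorem IsCenteredGaussian.inner_wick (hX : IsCenteredGaussian X P) (f h : firstChaos X P) :
    inner ℝ (hX.wick f) (hX.wick h) = Real.exp (inner ℝ f h) := by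
  rw [inner_eq_integral_mul, Submodule.coe_inner, ← hX.integral_wickExp_mul f.2 h.2]
  refine integral_congr_ae ?_
  filter_upwards [hX.coeFn_wick f, hX.coeFn_wick h] with ω h1 h2
  rw [h1, h2]

theorem IsCenteredGaussian.norm_wick (hX : IsCenteredGaussian X P) (h : firstChaos X P) :
    ‖hX.wick h‖ = Real.exp (‖h‖ ^ 2 / 2) := by
  have : ‖hX.wick h‖ ^ 2 = Real.exp (‖h‖ ^ 2 / 2) ^ 2 := by
    rw [← real_inner_self_eq_norm_sq, hX.inner_wick, real_inner_self_eq_norm_sq,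
      ← Real.exp_nat_mul]
    congr 1
    push_cast
    ring
  exact (sq_eq_sq₀ (norm_nonneg _) (Real.exp_pos _).le).1 this

/-- Expanding the square, `inner_wick` expresses the distance between two Wick exponentials through
inner products in the chaos. This continuity makes it enough to check S-transform identities on a
dense set. -/
theorem IsCenteredGaussian.continuous_wick (hX : IsCenteredGaussian X P) :
    Continuous hX.wick := by
  refine continuous_iff_continuousAt.2 fun h => ?_
  have key (f : firstChaos X P) : ‖hX.wick f - hX.wick h‖ =
      √(Real.exp (inner ℝ f f) - 2 * Real.exp (inner ℝ f h) + Real.exp (inner ℝ h h)) := by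
    rw [← hX.inner_wick, ← hX.inner_wick, ← hX.inner_wick, real_inner_self_eq_norm_sq,
      real_inner_self_eq_norm_sq, ← norm_sub_sq_real, Real.sqrt_sq (norm_nonneg _)]
  rw [ContinuousAt, tendsto_iff_norm_sub_tendsto_zero]
  simp_rw [key]
  have hc : Continuous fun f : firstChaos X P =>
      √(Real.exp (inner ℝ f f) - 2 * Real.exp (inner ℝ f h) + Real.exp (inner ℝ h h)) := by
    fun_prop
  convert! hc.tendsto h using 2
  rw [eq_comm, Real.sqrt_eq_zero']
  linarith

theorem IsCenteredGaussian.aestronglyMeasurable_wick (hX : IsCenteredGaussian X P)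
    (h : firstChaos X P) : AEStronglyMeasurable[hX.filtration ⊤] (hX.wick h) P :=
  (aestronglyMeasurable_wickExp _ (hX.aestronglyMeasurable_of_mem_past
    (hX.firstChaos_eq_past ▸ h.2))).congr (hX.coeFn_wick h).symm

theorem IsCenteredGaussian.sTransform_eq_inner (hX : IsCenteredGaussian X P) {V : Ω → ℝ}
    (hV : MemLp V 2 P) (h : firstChaos X P) :
    sTransform P V h = inner ℝ (hX.wick h) (hV.toLp V) := by
  rw [inner_eq_integral_mul, sTransform]
  refine integral_congr_ae ?_
  filter_upwards [hX.coeFn_wick h, hV.coeFn_toLp] with ω h1 h2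
  rw [h1, h2, smul_eq_mul]

theorem IsCenteredGaussian.continuous_sTransform (hX : IsCenteredGaussian X P) {V : Ω → ℝ}
    (hV : MemLp V 2 P) : Continuous fun h : firstChaos X P => sTransform P V h := by
  simp_rw [hX.sTransform_eq_inner hV]
  exact hX.continuous_wick.inner continuous_const

theorem IsCenteredGaussian.abs_sTransform_le (hX : IsCenteredGaussian X P) {V : Ω → ℝ}
    (hV : MemLp V 2 P) (h : firstChaos X P) :
    |sTransform P V h| ≤ Real.exp (‖h‖ ^ 2 / 2) * ‖hV.toLp V‖ := by
  rw [hX.sTransform_eq_inner hV, ← hX.norm_wick]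
  exact abs_real_inner_le_norm _ _

theorem IsCenteredGaussian.integrable_wickExp_smul (hX : IsCenteredGaussian X P) {E : Type v}
    [NormedAddCommGroup E] [NormedSpace ℝ E] {V : Ω → E} (hV : MemLp V 2 P)
    {h : Lp ℝ 2 P} (hh : h ∈ firstChaos X P) : Integrable (fun ω => wickExp P h ω • V ω) P :=
  memLp_one_iff_integrable.1 (hV.smul (r := 1) (hX.memLp_wickExp hh))

/-- The `S`-transform of an `ℱ_t`-measurable variable depends on the Cameron-Martin function on
`[0, t]` only. -/
theorem IsCenteredGaussian.sTransform_congr (hX : IsCenteredGaussian X P) {t : TimeInterval T}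
    {V : Ω → ℝ} (hVm : AEStronglyMeasurable[hX.filtration t] V P)
    {f h : Lp ℝ 2 P} (hf : f ∈ firstChaos X P) (hh : h ∈ firstChaos X P)
    (H : ∀ s ≤ t, inner ℝ (hX.val s) f = inner ℝ (hX.val s) h) :
    sTransform P V f = sTransform P V h := by
  have := hX.gaussian.isProbabilityMeasure
  have : CompleteSpace (hX.past t) := (Submodule.isClosed_topologicalClosure _).completeSpace_coe
  -- Split `g` into its projection `p` on the past and the remainder. The Wick exponential
  -- factorises, and the factor of `g - p` is independent of `ℱ_t` with mean `1`, so only `p`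
  -- matters.
  have key {g : Lp ℝ 2 P} (hg : g ∈ firstChaos X P) :
      sTransform P V g = sTransform P V ((hX.past t).starProjection g) := by
    set p := (hX.past t).starProjection g with hp
    have hpm : p ∈ hX.past t := by simp [hp]
    have hpc := hX.past_le_firstChaos t hpm
    have hk : g - p ∈ firstChaos X P := sub_mem hg hpc
    have hko : g - p ∈ (hX.past t)ᗮ := by
      simp [hp]
    have ind := hX.indep_filtration hk fun s hs =>
      Submodule.inner_right_of_mem_orthogonal (hX.val_mem_past hs) hko
    have h0 : inner ℝ (g - p) p = 0 := Submodule.inner_left_of_mem_orthogonal hpm hko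
    have hprod : AEStronglyMeasurable[hX.filtration t] (fun ω => wickExp P p ω * V ω) P :=
      (aestronglyMeasurable_wickExp p (hX.aestronglyMeasurable_of_mem_past hpm)).mul hVm
    have ind2 : IndepFun (wickExp P (g - p)) (fun ω => wickExp P p ω * V ω) P := by
      obtain ⟨W, hW, hWV⟩ := hprod
      have : IndepFun (wickExp P (g - p)) W P := by
        refine indep_of_indep_of_le_left (indep_of_indep_of_le_right ind hW.measurable.comap_le) ?_
        have : Measurable fun x : ℝ => Real.exp (x - ‖g - p‖ ^ 2 / 2) := by fun_prop
        have h2 : wickExp P (g - p) = (fun x : ℝ => Real.exp (x - ‖g - p‖ ^ 2 / 2)) ∘ ↑↑(g - p) :=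
          funext (wickExp_eq _)
        rw [h2, ← MeasurableSpace.comap_comp]
        exact MeasurableSpace.comap_mono this.comap_le
      exact this.congr .rfl hWV.symm
    calc sTransform P V g = ∫ ω, wickExp P (g - p) ω * (wickExp P p ω * V ω) ∂P := by
          refine integral_congr_ae ?_
          have := wickExp_add (g - p) p
          rw [h0, Real.exp_zero, sub_add_cancel] at this
          filter_upwards [this] with ω hω
          rw [smul_eq_mul, ← mul_assoc, hω, one_mul]
      _ = (∫ ω, wickExp P (g - p) ω ∂P) * ∫ ω, wickExp P p ω * V ω ∂P :=
          ind2.integral_fun_mul_eq_mul_integral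
            (aestronglyMeasurable_wickExp _ (Lp.aestronglyMeasurable _))
            (hprod.mono (hX.filtration.le t))
      _ = sTransform P V p := by
          rw [hX.integral_wickExp hk, one_mul]
          rfl
  rw [key hf, key hh]
  congr 1
  have : f - h ∈ (hX.past t)ᗮ := hX.mem_past_orthogonal fun s hs => by
    rw [inner_sub_right, H s hs, sub_self]
  rw [← sub_eq_zero, ← map_sub]
  exact (Submodule.starProjection_apply_eq_zero_iff _).2 this

end Wick

/-! ### The Wiener integral, the stopping operator, and the martingale criterion. -/

section Truncation

variable {Ω : Type u} {mΩ : MeasurableSpace Ω} {T : ℝ} [Fact (0 ≤ T)]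
  {X : TimeInterval T → Ω → ℝ} {P : Measure Ω}

theorem elementaryIntegral_formalIndicator (hX : IsCenteredGaussian X P) (t : TimeInterval T) :
    elementaryIntegral hX (formalIndicator hX t) = hX.val t := by
  simp [elementaryIntegral, formalIndicator, Finsupp.linearCombination_single,
    IsCenteredGaussian.val]

theorem elementaryIntegral_mem_firstChaos (hX : IsCenteredGaussian X P) (f : FormalStep hX) :
    elementaryIntegral hX f ∈ firstChaos X P := by
  rw [elementaryIntegral, LinearMap.comp_apply, Finsupp.linearCombination_apply]
  exact sum_mem fun t _ => Submodule.smul_mem _ _ (hX.val_mem_firstChaos t)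

theorem norm_elementaryIntegral (hX : IsCenteredGaussian X P) (f : FormalStep hX) :
    ‖elementaryIntegral hX f‖ = ‖f‖ := by
  have : ‖elementaryIntegral hX f‖ ^ 2 = ‖f‖ ^ 2 := by
    rw [← real_inner_self_eq_norm_sq, ← real_inner_self_eq_norm_sq]
    rfl
  exact (sq_eq_sq₀ (norm_nonneg _) (norm_nonneg _)).1 this

/-- The Wiener integral: an isometry from the space of deterministic integrands to the first
chaos mapping `1_{(0,t]}` to `X_t`. -/
theorem exists_wienerIntegral (hX : IsCenteredGaussian X P) :
    ∃ J : DetIntegrands hX →ₗᵢ[ℝ] Lp ℝ 2 P,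
      (∀ f, J f ∈ firstChaos X P) ∧ ∀ t, J (detIndicator hX t) = hX.val t := by
  let e : FormalStep hX →ₗ[ℝ] DetIntegrands hX :=
    (UniformSpace.Completion.toComplₗᵢ (𝕜 := ℝ) (E := FormalStep hX)).toLinearMap
  have hd : DenseRange e := UniformSpace.Completion.denseRange_coe
  have he (f : FormalStep hX) : ‖e f‖ = ‖f‖ := UniformSpace.Completion.norm_coe f
  let J := (elementaryIntegral hX).extendOfNorm e
  have hJ (f : FormalStep hX) : J (e f) = elementaryIntegral hX f :=
    LinearMap.extendOfNorm_eq hd ⟨1, fun x => by rw [he, norm_elementaryIntegral, one_mul]⟩ f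
  refine ⟨⟨J.toLinearMap, fun f => ?_⟩, fun f => ?_, fun t => ?_⟩
  · refine hd.induction_on f (isClosed_eq J.continuous.norm continuous_norm) fun a => ?_
    rw [ContinuousLinearMap.coe_coe, hJ, he, norm_elementaryIntegral]
  · refine hd.induction_on (p := fun f => J f ∈ firstChaos X P) f
      (isClosed_firstChaos.preimage J.continuous) fun a => ?_
    rw [hJ]
    exact elementaryIntegral_mem_firstChaos hX a
  · exact (hJ (formalIndicator hX t)).trans (elementaryIntegral_formalIndicator hX t)

/-- If `X` has an indefinite Wiener integral, stopping the Cameron-Martin functions at time `t`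
is a continuous linear operation. -/
theorem exists_stopping (hX : IsCenteredGaussian X P) (hI : HasIndefiniteWienerIntegral hX)
    (t : TimeInterval T) : ∃ B : firstChaos X P →L[ℝ] firstChaos X P,
      ∀ (u : TimeInterval T) (h : firstChaos X P),
        inner ℝ (hX.val u) (B h : Lp ℝ 2 P) = inner ℝ (hX.val (min u t)) (h : Lp ℝ 2 P) := by
  obtain ⟨J, hJ, hJi⟩ := exists_wienerIntegral hX
  obtain ⟨𝓘, h𝓘⟩ := hI
  let J' : DetIntegrands hX →L[ℝ] firstChaos X P := J.toContinuousLinearMap.codRestrict _ hJ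
  -- `J` identifies integrands with chaos elements, so stopping is `J 𝓘_t* J*`: the truncation of
  -- the indicators moved to the other side of the pairing.
  refine ⟨J' ∘L (𝓘 t).adjoint ∘L J.toContinuousLinearMap.adjoint ∘L (firstChaos X P).subtypeL,
    fun u h => ?_⟩
  have h1 : ((J' ∘L (𝓘 t).adjoint ∘L J.toContinuousLinearMap.adjoint ∘L
      (firstChaos X P).subtypeL) h : Lp ℝ 2 P)
      = J ((𝓘 t).adjoint (J.toContinuousLinearMap.adjoint h)) := rfl
  rw [h1, ← hJi u, J.inner_map_map, ContinuousLinearMap.adjoint_inner_right,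
    ContinuousLinearMap.adjoint_inner_right, h𝓘]
  exact congrArg (inner ℝ · (h : Lp ℝ 2 P)) (hJi _)

/-- The quadratic `2r⟨x, y⟩ + r²‖y‖²` is nonnegative for all `r`, so its discriminant forces the
linear coefficient to vanish. -/
theorem inner_eq_zero_of_norm_le_norm_add_smul {E : Type*} [NormedAddCommGroup E]
    [InnerProductSpace ℝ E] {x y : E} (H : ∀ r : ℝ, ‖x‖ ≤ ‖x + r • y‖) : inner ℝ x y = 0 := by
  have := discrim_le_zero (a := ‖y‖ ^ 2) (b := 2 * inner ℝ x y) (c := 0) fun r => by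
    have h1 := pow_le_pow_left₀ (norm_nonneg _) (H r) 2
    rw [norm_add_sq_real, inner_smul_right, norm_smul, mul_pow, Real.norm_eq_abs, sq_abs] at h1
    linarith
  rw [discrim] at this
  nlinarith [sq_nonneg (inner ℝ x y)]

/-- If stopping the Cameron-Martin functions is contractive, then `X` is a martingale. -/
theorem martingale_of_stopping_contractive (hX : IsCenteredGaussian X P)
    (H : ∀ t : TimeInterval T, ∃ B : firstChaos X P →L[ℝ] firstChaos X P,
      (∀ (u : TimeInterval T) (h : firstChaos X P),
        inner ℝ (hX.val u) (B h : Lp ℝ 2 P) = inner ℝ (hX.val (min u t)) (h : Lp ℝ 2 P)) ∧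
      ∀ h, ‖B h‖ ≤ ‖h‖) :
    Martingale X hX.filtration P := by
  have := hX.gaussian.isProbabilityMeasure
  refine ⟨Filtration.stronglyAdapted_natural hX.stronglyMeasurable, fun t u htu => ?_⟩
  obtain ⟨B, hB, hBn⟩ := H t
  set k : Lp ℝ 2 P := hX.val u - hX.val t with hk
  have hkc : k ∈ firstChaos X P := sub_mem (hX.val_mem_firstChaos u) (hX.val_mem_firstChaos t)
  have orth : ∀ s ≤ t, inner ℝ (hX.val s) k = 0 := fun s hs => by
    refine inner_eq_zero_of_norm_le_norm_add_smul fun r => ?_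
    let f : firstChaos X P := ⟨hX.val s, hX.val_mem_firstChaos s⟩
    -- Both `X_u` and `X_t` are stopped to `X_t`, so `k` is orthogonal to the range of `B`; the
    -- contraction bound then makes `X_s` the shortest vector on the line `X_s + r k`.
    have h1 : inner ℝ (hX.val s + r • k) (B f : Lp ℝ 2 P) = ‖hX.val s‖ ^ 2 := by
      rw [inner_add_left, inner_smul_left, hk, inner_sub_left, hB, hB, hB, min_self,
        min_eq_left hs, min_eq_right htu, sub_self, mul_zero, add_zero, real_inner_self_eq_norm_sq]
    have h2 : ‖hX.val s‖ ^ 2 ≤ ‖hX.val s + r • k‖ * ‖hX.val s‖ := by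
      rw [← h1]
      exact (real_inner_le_norm _ _).trans
        (mul_le_mul_of_nonneg_left (hBn f) (norm_nonneg _))
    rcases (norm_nonneg (hX.val s)).eq_or_lt with h0 | h0
    · rw [← h0]
      exact norm_nonneg _
    · rw [sq] at h2
      exact le_of_mul_le_mul_right h2 h0
  have hce := condExp_indep_eq (Lp.stronglyMeasurable k).measurable.comap_le
    (hX.filtration.le t) (comap_measurable k).stronglyMeasurable (hX.indep_filtration hkc orth)
  have hsm : StronglyMeasurable[hX.filtration t] (X t) :=
    Filtration.stronglyAdapted_natural hX.stronglyMeasurable t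
  have hint (s : TimeInterval T) : Integrable (X s) P :=
    (hX.gaussian.hasGaussianLaw_eval s).integrable
  have hXu : X u =ᵐ[P] k + X t := by
    filter_upwards [Lp.coeFn_sub (hX.val u) (hX.val t), hX.coeFn_val u, hX.coeFn_val t]
      with ω h1 h2 h3
    rw [Pi.add_apply, hk, h1, Pi.sub_apply, h2, h3, sub_add_cancel]
  have hki : Integrable k P := (Lp.memLp k).integrable (by norm_num)
  refine (condExp_congr_ae hXu).trans ((condExp_add hki (hint t) _).trans ?_)
  rw [condExp_of_stronglyMeasurable (hX.filtration.le t) hsm (hint t)]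
  filter_upwards [hce] with ω hω
  rw [Pi.add_apply, hω, hX.integral_eq_zero hkc, zero_add]

end Truncation

/-! ### Lebesgue–Stieltjes integrals against a continuous integrator. -/

section Stieltjes

variable {T : ℝ} {γ : TimeInterval T → ℝ}

instance (hγ : BoundedVariationOn γ Set.univ) : IsFiniteMeasure (totalVar hγ) := by
  unfold totalVar
  infer_instance

/-- The variation measure of a continuous function of bounded variation has no atoms. -/
theorem nullSingletonClass_totalVar (hγ : BoundedVariationOn γ Set.univ) (hc : Continuous γ) :
    NullSingletonClass (totalVar hγ) := by
  refine ⟨fun x => ?_⟩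
  set j := (stieltjes hγ).toJordanDecomposition
  have h0 : stieltjes hγ {x} = 0 := by
    rw [stieltjes, BoundedVariationOn.vectorMeasure_singleton,
      hc.continuousWithinAt.leftLim_eq, hc.continuousWithinAt.rightLim_eq, sub_self]
  rw [SignedMeasure.apply_eq_posPart_real_sub_negPart_real _ (measurableSet_singleton x),
    sub_eq_zero] at h0
  -- Continuity of `γ` makes the two Jordan parts agree on `{x}`; being mutually singular, one of
  -- them vanishes there, hence both.
  have h1 : j.posPart {x} = j.negPart {x} :=
    (measureReal_eq_measureReal_iff (measure_ne_top _ _) (measure_ne_top _ _)).1 h0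
  obtain ⟨S, -, -, -, hpos, hneg⟩ := j.exists_compl_positive_negative
  have h2 : j.posPart {x} = 0 ∨ j.negPart {x} = 0 := by
    by_cases hx : x ∈ S
    · exact .inl (measure_mono_null (Set.singleton_subset_iff.2 hx) hpos)
    · exact .inr (measure_mono_null (Set.singleton_subset_iff.2 hx) hneg)
  change j.posPart {x} + j.negPart {x} = 0
  rcases h2 with h2 | h2
  · rw [← h1, h2, add_zero]
  · rw [h1, h2, add_zero]

theorem posPart_le_totalVar (hγ : BoundedVariationOn γ Set.univ) :
    (stieltjes hγ).toJordanDecomposition.posPart ≤ totalVar hγ :=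
  Measure.le_add_right le_rfl

theorem negPart_le_totalVar (hγ : BoundedVariationOn γ Set.univ) :
    (stieltjes hγ).toJordanDecomposition.negPart ≤ totalVar hγ :=
  Measure.le_add_left le_rfl

theorem stieltjesIntegral_sub (hγ : BoundedVariationOn γ Set.univ) (B : Set (TimeInterval T))
    {f g : TimeInterval T → ℝ} (hf : Integrable f (totalVar hγ))
    (hg : Integrable g (totalVar hγ)) :
    stieltjesIntegral hγ B (fun s => f s - g s)
      = stieltjesIntegral hγ B f - stieltjesIntegral hγ B g := by
  have hp := posPart_le_totalVar hγ
  have hn := negPart_le_totalVar hγ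
  rw [stieltjesIntegral, integral_sub (hf.mono_measure hp).integrableOn
    (hg.mono_measure hp).integrableOn, integral_sub (hf.mono_measure hn).integrableOn
    (hg.mono_measure hn).integrableOn, stieltjesIntegral, stieltjesIntegral]
  ring

theorem stieltjesIntegral_union (hγ : BoundedVariationOn γ Set.univ) {A B : Set (TimeInterval T)}
    (hAB : Disjoint A B) (hB : MeasurableSet B) {f : TimeInterval T → ℝ}
    (hf : Integrable f (totalVar hγ)) :
    stieltjesIntegral hγ (A ∪ B) f = stieltjesIntegral hγ A f + stieltjesIntegral hγ B f := by
  have hp := hf.mono_measure (posPart_le_totalVar hγ)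
  have hn := hf.mono_measure (negPart_le_totalVar hγ)
  rw [stieltjesIntegral, setIntegral_union hAB hB hp.integrableOn hp.integrableOn,
    setIntegral_union hAB hB hn.integrableOn hn.integrableOn, stieltjesIntegral, stieltjesIntegral]
  ring

theorem stieltjesIntegral_congr (hγ : BoundedVariationOn γ Set.univ) (B : Set (TimeInterval T))
    {f g : TimeInterval T → ℝ} (h : f =ᵐ[totalVar hγ] g) :
    stieltjesIntegral hγ B f = stieltjesIntegral hγ B g := by
  have hp := (posPart_le_totalVar hγ).absolutelyContinuous.ae_eq h
  have hn := (negPart_le_totalVar hγ).absolutelyContinuous.ae_eq h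
  rw [stieltjesIntegral, stieltjesIntegral, integral_congr_ae (ae_restrict_of_ae hp),
    integral_congr_ae (ae_restrict_of_ae hn)]

theorem abs_stieltjesIntegral_le (hγ : BoundedVariationOn γ Set.univ) (B : Set (TimeInterval T))
    {f : TimeInterval T → ℝ} (hf : Integrable f (totalVar hγ)) :
    |stieltjesIntegral hγ B f| ≤ ∫ s in B, |f s| ∂totalVar hγ := by
  have hp := hf.abs.mono_measure (posPart_le_totalVar hγ)
  have hn := hf.abs.mono_measure (negPart_le_totalVar hγ)
  calc |stieltjesIntegral hγ B f| ≤ _ := abs_sub _ _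
    _ ≤ (∫ s in B, |f s| ∂(stieltjes hγ).toJordanDecomposition.posPart)
        + ∫ s in B, |f s| ∂(stieltjes hγ).toJordanDecomposition.negPart :=
      add_le_add abs_integral_le_integral_abs abs_integral_le_integral_abs
    _ = ∫ s in B, |f s| ∂totalVar hγ := by
      rw [totalVar, SignedMeasure.totalVariation, Measure.restrict_add,
        integral_add_measure hp.integrableOn hn.integrableOn]

end Stieltjes

/-! ### A Grönwall inequality for atomless measures. -/

section Gronwall

variable {T : ℝ} [Fact (0 ≤ T)] {ν : Measure (TimeInterval T)}

omit [Fact (0 ≤ T)] in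
theorem continuous_setIntegral_Iic [NullSingletonClass ν] {a : TimeInterval T → ℝ} (ha : Integrable a ν) :
    Continuous fun s => ∫ r in Set.Iic s, a r ∂ν := by
  simp_rw [← integral_indicator (measurableSet_Iic (α := TimeInterval T))]
  refine continuous_iff_continuousAt.2 fun s₀ => continuousAt_of_dominated
    (bound := fun r => ‖a r‖) (.of_forall fun s => ha.aestronglyMeasurable.indicator
      measurableSet_Iic) (.of_forall fun s => .of_forall fun r => norm_indicator_le_norm_self _ _)
    ha.norm ?_
  -- For `r ≠ s₀` the indicator of `r ≤ s` is locally constant in `s` near `s₀`; the exceptional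
  -- point is null.
  filter_upwards [(measure_singleton s₀ : ν {s₀} = 0) |> measure_eq_zero_iff_ae_notMem.1] with r hr
  rcases lt_or_gt_of_ne (show r ≠ s₀ from hr) with h | h
  · refine ContinuousAt.congr (f := fun _ => a r) continuousAt_const ?_
    filter_upwards [Ioi_mem_nhds h] with s hs
    rw [Set.indicator_of_mem (show r ∈ Set.Iic s from (Set.mem_Ioi.1 hs).le)]
  · refine ContinuousAt.congr (f := fun _ => (0 : ℝ)) continuousAt_const ?_
    filter_upwards [Iio_mem_nhds h] with s hs
    exact (Set.indicator_of_notMem (s := Set.Iic s) (fun hr' => (Set.mem_Iio.1 hs).not_ge hr') a).symm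

/-- A Grönwall lemma for an atomless measure: the final value of a solution of a linear
integral inequality is controlled by its initial value. -/
theorem exists_gronwall_bound [NullSingletonClass ν] {a : TimeInterval T → ℝ} (ha : Integrable a ν)
    (t : TimeInterval T) : ∃ C : ℝ, 0 ≤ C ∧ ∀ δ : TimeInterval T → ℝ,
      Integrable (fun s => a s * δ s) ν →
      (∀ s₁ s₂, t ≤ s₁ → s₁ ≤ s₂ → |δ s₂ - δ s₁| ≤ ∫ s in Set.Ioc s₁ s₂, |a s * δ s| ∂ν) →
      |δ ⊤| ≤ C * |δ t| := by
  set F : TimeInterval T → ℝ := fun s => ∫ r in Set.Iic s, |a r| ∂ν with hF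
  have hFc : Continuous F := continuous_setIntegral_Iic ha.abs
  have hFsub {s₁ s₂ : TimeInterval T} (h : s₁ ≤ s₂) :
      ∫ r in Set.Ioc s₁ s₂, |a r| ∂ν = F s₂ - F s₁ := by
    rw [hF, eq_sub_iff_add_eq', ← setIntegral_union (Set.Iic_disjoint_Ioc le_rfl)
      measurableSet_Ioc ha.abs.integrableOn ha.abs.integrableOn, Set.Iic_union_Ioc_eq_Iic h]
  have hFmono : Monotone F := fun s₁ s₂ h => by
    rw [← sub_nonneg, ← hFsub h]
    exact integral_nonneg fun _ => abs_nonneg _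
  -- On a stretch carrying at most `1/2` of the mass of `|a|`, the supremum `M` of `|δ|` satisfies
  -- `M ≤ |δ s₀| + M/2`. It is finite by integrability of `a δ`, so it can be absorbed.
  have step {δ : TimeInterval T → ℝ} (hδ : Integrable (fun s => a s * δ s) ν)
      (H : ∀ s₁ s₂, t ≤ s₁ → s₁ ≤ s₂ → |δ s₂ - δ s₁| ≤ ∫ s in Set.Ioc s₁ s₂, |a s * δ s| ∂ν)
      {s₀ s₁ : TimeInterval T} (h0 : t ≤ s₀) (h01 : s₀ ≤ s₁) (hF1 : F s₁ ≤ F s₀ + 1 / 2) :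
      |δ s₁| ≤ 2 * |δ s₀| := by
    set A : Set ℝ := (fun s => |δ s|) '' Set.Icc s₀ s₁
    have hbdd : BddAbove A := by
      refine ⟨|δ s₀| + ∫ s, |a s * δ s| ∂ν, ?_⟩
      rintro _ ⟨s, hs, rfl⟩
      have h1 := H s₀ s h0 hs.1
      have h2 : ∫ r in Set.Ioc s₀ s, |a r * δ r| ∂ν ≤ ∫ r, |a r * δ r| ∂ν :=
        setIntegral_le_integral hδ.abs (.of_forall fun _ => abs_nonneg _)
      have h3 := abs_sub_abs_le_abs_sub (δ s) (δ s₀)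
      change |δ s| ≤ _
      linarith
    have hne : A.Nonempty := ⟨_, s₀, Set.left_mem_Icc.2 h01, rfl⟩
    have hM0 : 0 ≤ sSup A :=
      (abs_nonneg _).trans (le_csSup hbdd ⟨s₀, Set.left_mem_Icc.2 h01, rfl⟩)
    have key : ∀ s ∈ Set.Icc s₀ s₁, |δ s| ≤ |δ s₀| + sSup A / 2 := fun s hs => by
      have h1 := H s₀ s h0 hs.1
      have h2 : ∫ r in Set.Ioc s₀ s, |a r * δ r| ∂ν ≤ ∫ r in Set.Ioc s₀ s, |a r| * sSup A ∂ν := by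
        refine setIntegral_mono_on hδ.abs.integrableOn (ha.abs.mul_const _).integrableOn
          measurableSet_Ioc fun r hr => ?_
        rw [abs_mul]
        exact mul_le_mul_of_nonneg_left
          (le_csSup hbdd ⟨r, ⟨hr.1.le, hr.2.trans hs.2⟩, rfl⟩) (abs_nonneg _)
      rw [integral_mul_const, hFsub hs.1] at h2
      have h3 := abs_sub_abs_le_abs_sub (δ s) (δ s₀)
      have h4 : (F s - F s₀) * sSup A ≤ 1 / 2 * sSup A :=
        mul_le_mul_of_nonneg_right (by linarith [hFmono hs.2]) hM0
      linarith
    have hM : sSup A ≤ |δ s₀| + sSup A / 2 := by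
      refine csSup_le hne ?_
      rintro _ ⟨s, hs, rfl⟩
      exact key s hs
    have := key s₁ (Set.right_mem_Icc.2 h01)
    linarith
  have main {δ : TimeInterval T → ℝ} (hδ : Integrable (fun s => a s * δ s) ν)
      (H : ∀ s₁ s₂, t ≤ s₁ → s₁ ≤ s₂ → |δ s₂ - δ s₁| ≤ ∫ s in Set.Ioc s₁ s₂, |a s * δ s| ∂ν)
      -- `n` counts the half-units of mass left before `⊤`; each one costs a factor `2`.
      (n : ℕ) : ∀ s₀, t ≤ s₀ → F ⊤ ≤ F s₀ + n / 2 → |δ ⊤| ≤ 2 ^ (n + 1) * |δ s₀| := by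
    induction n with
    | zero =>
      intro s₀ h0 hn
      rw [zero_add, pow_one]
      exact step hδ H h0 le_top (by push_cast at hn; linarith)
    | succ n ih =>
      intro s₀ h0 hn
      obtain ⟨s₁, h1, h01⟩ : ∃ s₁, F s₁ = min (F s₀ + 1 / 2) (F ⊤) ∧ s₀ ≤ s₁ := by
        obtain ⟨s, hs⟩ := mem_range_of_exists_le_of_exists_ge hFc
          (c := min (F s₀ + 1 / 2) (F ⊤)) ⟨s₀, le_min (by linarith) (hFmono le_top)⟩
          ⟨⊤, min_le_right _ _⟩
        rcases le_total s₀ s with h | h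
        · exact ⟨s, hs, h⟩
        -- If the intermediate value is attained only to the left of `s₀`, monotonicity shows that
        -- `s₀` attains it too: no mass is left.
        · refine ⟨s₀, le_antisymm (le_min (by linarith) (hFmono le_top)) ?_, le_rfl⟩
          rw [← hs]
          exact hFmono h
      have hs := step hδ H h0 h01 (h1.trans_le (min_le_left _ _))
      have hr := ih s₁ (h0.trans h01) (by
        push_cast at hn
        rw [h1]
        rcases min_choice (F s₀ + 1 / 2) (F ⊤) with h | h <;> rw [h]
        · linarith
        · have : (0 : ℝ) ≤ n := n.cast_nonneg
          linarith)
      calc |δ ⊤| ≤ 2 ^ (n + 1) * |δ s₁| := hr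
        _ ≤ 2 ^ (n + 1) * (2 * |δ s₀|) := by gcongr
        _ = 2 ^ (n + 1 + 1) * |δ s₀| := by ring
  obtain ⟨n, hn⟩ := exists_nat_ge (2 * (F ⊤ - F t))
  exact ⟨2 ^ (n + 1), by positivity, fun δ hδ H => main hδ H n t le_rfl (by linarith)⟩

end Gronwall

/-! ### Interchanging the S-transform with `dγ`. -/

section Fubini

variable {Ω : Type u} {mΩ : MeasurableSpace Ω} {P : Measure Ω}

/-- Bound the product of `|w|` and the inner integral of `|f|` by the sum of their squares. With `w`
a Wick exponential this is the hypothesis of Fubini's theorem. -/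
theorem integrable_prod_mul_of_lintegral_sq_lt_top [SFinite P] {S : Type*} [MeasurableSpace S]
    {ν : Measure S} [SFinite ν] {w : Ω → ℝ} (hw : MemLp w 2 P) {f : S → Ω → ℝ}
    (hf : Measurable fun p : S × Ω => f p.1 p.2)
    (hfi : ∫⁻ ω, (∫⁻ s, ‖f s ω‖ₑ ∂ν) ^ 2 ∂P < ∞) :
    Integrable (fun p : S × Ω => w p.2 * f p.1 p.2) (ν.prod P) := by
  have hm : AEStronglyMeasurable (fun p : S × Ω => w p.2 * f p.1 p.2) (ν.prod P) :=
    hw.aestronglyMeasurable.comp_snd.mul hf.aestronglyMeasurable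
  refine ⟨hm, ?_⟩
  have hsq : ∫⁻ ω, ‖w ω‖ₑ ^ 2 ∂P < ∞ := by
    have := hw.eLpNorm_lt_top
    rw [eLpNorm_lt_top_iff_lintegral_rpow_enorm_lt_top (by norm_num) (by norm_num)] at this
    simpa using this
  rw [hasFiniteIntegral_iff_enorm, lintegral_prod_symm _ hm.enorm]
  calc ∫⁻ ω, ∫⁻ s, ‖w ω * f s ω‖ₑ ∂ν ∂P = ∫⁻ ω, ‖w ω‖ₑ * ∫⁻ s, ‖f s ω‖ₑ ∂ν ∂P := by
        refine lintegral_congr fun ω => ?_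
        rw [← lintegral_const_mul _ (by fun_prop)]
        simp_rw [enorm_mul]
    _ ≤ ∫⁻ ω, (‖w ω‖ₑ ^ 2 + (∫⁻ s, ‖f s ω‖ₑ ∂ν) ^ 2) ∂P := by
        refine lintegral_mono fun ω => ?_
        rcases le_total ‖w ω‖ₑ (∫⁻ s, ‖f s ω‖ₑ ∂ν) with h | h
        · exact (mul_le_mul_left h _).trans ((sq _).symm.le.trans le_add_self)
        · exact (mul_le_mul_right h _).trans ((sq _).symm.le.trans le_self_add)
    _ = _ := lintegral_add_left' (hw.aestronglyMeasurable.enorm.pow_const 2) _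
    _ < ∞ := ENNReal.add_lt_top.2 ⟨hsq, hfi⟩

variable {T : ℝ} {γ : TimeInterval T → ℝ}

/-- The `S`-transform commutes with Lebesgue-Stieltjes integration. -/
theorem sTransform_stieltjesIntegral [SFinite P] (hγ : BoundedVariationOn γ Set.univ)
    (B : Set (TimeInterval T)) (h : Lp ℝ 2 P) {f : TimeInterval T → Ω → ℝ}
    (hf : Integrable (fun p : TimeInterval T × Ω => wickExp P h p.2 * f p.1 p.2)
      ((totalVar hγ).prod P)) :
    sTransform P (fun ω => stieltjesIntegral hγ B fun s => f s ω) h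
      = stieltjesIntegral hγ B fun s => sTransform P (f s) h := by
  have key {ν : Measure (TimeInterval T)} [IsFiniteMeasure ν] (hν : ν ≤ totalVar hγ) :
      Integrable (fun ω => wickExp P h ω * ∫ s in B, f s ω ∂ν) P ∧
      ∫ ω, wickExp P h ω * ∫ s in B, f s ω ∂ν ∂P = ∫ s in B, sTransform P (f s) h ∂ν := by
    have hi := hf.mono_measure (Measure.prod_mono (Measure.restrict_le_self.trans hν) le_rfl :
      (ν.restrict B).prod P ≤ (totalVar hγ).prod P)
    simp_rw [← integral_const_mul]
    exact ⟨hi.integral_prod_right, (integral_integral_swap hi).symm⟩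
  obtain ⟨ip, ep⟩ := key (posPart_le_totalVar hγ)
  obtain ⟨im, em⟩ := key (negPart_le_totalVar hγ)
  simp_rw [sTransform, stieltjesIntegral, smul_eq_mul, mul_sub]
  rw [integral_sub ip im, ep, em]
  rfl

end Fubini

/-! ### S-transforms of mild solutions at stopped arguments. -/

section MildSolution

variable {Ω : Type u} {mΩ : MeasurableSpace Ω} {T : ℝ} [Fact (0 ≤ T)]
  {X : TimeInterval T → Ω → ℝ} {P : Measure Ω} {γ : TimeInterval T → ℝ}

theorem IsCenteredGaussian.sTransform_clm (hX : IsCenteredGaussian X P) {H H' : Type*}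
    [NormedAddCommGroup H] [NormedSpace ℝ H] [CompleteSpace H]
    [NormedAddCommGroup H'] [NormedSpace ℝ H'] [CompleteSpace H'] (A : H →L[ℝ] H')
    {Z : Ω → H} (hZ : MemLp Z 2 P) {h : Lp ℝ 2 P} (hh : h ∈ firstChaos X P) :
    sTransform P (fun ω => A (Z ω)) h = A (sTransform P Z h) := by
  simp_rw [sTransform, ← map_smul]
  exact A.integral_comp_comm (hX.integrable_wickExp_smul hZ hh)

/-- Along `h` with `h + c` stopped at time `t`, the `S`-transforms of the two integrals of `Z` over
`(s, T]`, `t ≤ s`, cancel. -/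
theorem sTransform_integrals_eq_zero (hX : IsCenteredGaussian X P)
    {H : Type v} [NormedAddCommGroup H] [InnerProductSpace ℝ H] [CompleteSpace H]
    {ι : TimeInterval T → H} (happ : IsAppropriate X P ι)
    {𝓘 : TimeInterval T → H →L[ℝ] H} (h𝓘 : IsTruncation ι 𝓘)
    {c₀ : firstChaos X P} {L : H →L[ℝ] ℝ} (hL : IsIntegral ι (cameronMartinFun X P c₀) L)
    {Z : Ω → H} (hZ : MemLp Z 2 P) {t s : TimeInterval T} (hts : t ≤ s) {V : Ω → ℝ}
    (hV : IsSkorokhodIntegral hX ι (fun ω => (𝓘 ⊤ - 𝓘 s) (Z ω)) V)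
    {B : firstChaos X P →L[ℝ] firstChaos X P}
    (hB : ∀ (u : TimeInterval T) (h : firstChaos X P),
        inner ℝ (hX.val u) (B h : Lp ℝ 2 P) = inner ℝ (hX.val (min u t)) (h : Lp ℝ 2 P))
    (k : firstChaos X P) :
    sTransform P (fun ω => L ((𝓘 ⊤ - 𝓘 s) (Z ω)) + V ω) (B k - c₀ : firstChaos X P) = 0 := by
  have hLZ : MemLp (fun ω => L ((𝓘 ⊤ - 𝓘 s) (Z ω))) 2 P := (L ∘L (𝓘 ⊤ - 𝓘 s)).comp_memLp' hZ
  have hQ : MemLp (fun ω => L ((𝓘 ⊤ - 𝓘 s) (Z ω)) + V ω) 2 P := hLZ.add hV.1.1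
  -- Both sides are continuous in `k`, so it suffices to treat the dense set of `k` that are
  -- integrators for `H`.
  refine closure_minimal (t := {k : firstChaos X P |
    sTransform P (fun ω => L ((𝓘 ⊤ - 𝓘 s) (Z ω)) + V ω) (B k - c₀ : firstChaos X P) = 0})
    (fun k hk => ?_) (isClosed_eq ((hX.continuous_sTransform hQ).comp (by fun_prop))
      continuous_const) (happ k)
  obtain ⟨-, htot, K, hK⟩ := hk
  set h : firstChaos X P := B k - c₀
  -- If `K` integrates against `k`, then `K ∘ 𝓘_t` integrates against `k` stopped at `t`; this makes
  -- `h` an admissible test element for the Skorokhod integral.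
  have hh : IsIntegral ι (cameronMartinFun X P h) (K ∘L 𝓘 t - L) := fun u => by
    rw [sub_apply, ContinuousLinearMap.comp_apply, h𝓘, hK, hL,
      hX.cameronMartinFun_eq, hX.cameronMartinFun_eq, hX.cameronMartinFun_eq, ← hB,
      ← inner_sub_right]
    rfl
  have hz : K ∘L 𝓘 t ∘L (𝓘 ⊤ - 𝓘 s) = 0 := by
    refine ContinuousLinearMap.ext_on htot ?_
    rintro _ ⟨u, rfl⟩
    simp only [ContinuousLinearMap.comp_apply, sub_apply, h𝓘 _ _, map_sub,
      min_assoc, min_eq_right hts, min_eq_right (le_top : t ≤ ⊤), sub_self,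
      map_zero, zero_apply]
  have e1 := hV.2 h h.2 _ hh
  have e2 : sTransform P (fun ω => (𝓘 ⊤ - 𝓘 s) (Z ω)) (h : Lp ℝ 2 P)
      = (𝓘 ⊤ - 𝓘 s) (sTransform P Z h) := hX.sTransform_clm _ hZ h.2
  have e3 : sTransform P (fun ω => L ((𝓘 ⊤ - 𝓘 s) (Z ω))) (h : Lp ℝ 2 P)
      = L ((𝓘 ⊤ - 𝓘 s) (sTransform P Z h)) := hX.sTransform_clm (L ∘L (𝓘 ⊤ - 𝓘 s)) hZ h.2
  have e4 := DFunLike.congr_fun hz (sTransform P Z (h : Lp ℝ 2 P))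
  simp only [ContinuousLinearMap.comp_apply, zero_apply] at e4
  rw [e2, sub_apply, ContinuousLinearMap.comp_apply, e4, zero_sub] at e1
  have e5 : sTransform P (fun ω => L ((𝓘 ⊤ - 𝓘 s) (Z ω)) + V ω) (h : Lp ℝ 2 P)
      = sTransform P (fun ω => L ((𝓘 ⊤ - 𝓘 s) (Z ω))) h + sTransform P V h := by
    simp_rw [sTransform, smul_add]
    exact integral_add (hX.integrable_wickExp_smul hLZ h.2)
      (hX.integrable_wickExp_smul hV.1.1 h.2)
  exact e5.trans (by rw [e1, e3, add_neg_cancel])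

variable {hX : IsCenteredGaussian X P} {hγ : BoundedVariationOn γ Set.univ}
  {a c : TimeInterval T → ℝ} {G : TimeInterval T → Ω → ℝ} {ξ : Ω → ℝ}
  {H : Type v} [NormedAddCommGroup H] [InnerProductSpace ℝ H] [CompleteSpace H]
  {ι : TimeInterval T → H} {Y : TimeInterval T → Ω → ℝ} {Z : Ω → H}

theorem IsMildSolution.integrable_prod (hS : IsMildSolution hX hγ a c G ξ ι Y Z)
    (ha : Measurable a) (h : firstChaos X P) :
    Integrable (fun p : TimeInterval T × Ω => wickExp P h p.2 * (a p.1 * Y p.1 p.2))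
      ((totalVar hγ).prod P) := by
  have := hX.gaussian.isProbabilityMeasure
  exact integrable_prod_mul_of_lintegral_sq_lt_top (ν := totalVar hγ)
    (f := fun s ω => a s * Y s ω) (hX.memLp_wickExp h.2)
    ((ha.comp measurable_fst).mul hS.measurable_Y) hS.integrable_Y

theorem IsMildSolution.integrable_sTransform (hS : IsMildSolution hX hγ a c G ξ ι Y Z)
    (ha : Measurable a) (h : firstChaos X P) :
    Integrable (fun s => a s * sTransform P (Y s) h) (totalVar hγ) := by
  have := hX.gaussian.isProbabilityMeasure
  refine (hS.integrable_prod ha h).integral_prod_left.congr (.of_forall fun s => ?_)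
  simp_rw [sTransform, smul_eq_mul, ← integral_const_mul]
  exact integral_congr_ae (.of_forall fun ω => by ring)

theorem IsAdmissible.integrable_prod (hcoef : IsAdmissible hX hγ a c G) (h : firstChaos X P) :
    Integrable (fun p : TimeInterval T × Ω => wickExp P h p.2 * G p.1 p.2)
      ((totalVar hγ).prod P) := by
  have := hX.gaussian.isProbabilityMeasure
  exact integrable_prod_mul_of_lintegral_sq_lt_top (ν := totalVar hγ) (hX.memLp_wickExp h.2)
    hcoef.measurable_G hcoef.integrable_G

theorem IsAdmissible.integrable_sTransform (hcoef : IsAdmissible hX hγ a c G)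
    (h : firstChaos X P) : Integrable (fun s => sTransform P (G s) h) (totalVar hγ) := by
  have := hX.gaussian.isProbabilityMeasure
  exact (hcoef.integrable_prod h).integral_prod_left

/-- The `S`-transform of a mild solution solves a deterministic linear equation on `[t, T]`, along
those `h` for which `h + c` is stopped at time `t`. -/
theorem IsMildSolution.sTransform_eq (hS : IsMildSolution hX hγ a c G ξ ι Y Z)
    (hcoef : IsAdmissible hX hγ a c G) (hξ : MemLp ξ 2 P)
    {c₀ : firstChaos X P} (hc : cameronMartinFun X P c₀ = c) {t s : TimeInterval T} (hts : t ≤ s)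
    {B : firstChaos X P →L[ℝ] firstChaos X P}
    (hB : ∀ (u : TimeInterval T) (h : firstChaos X P),
        inner ℝ (hX.val u) (B h : Lp ℝ 2 P) = inner ℝ (hX.val (min u t)) (h : Lp ℝ 2 P))
    (k : firstChaos X P) {h : firstChaos X P} (hh : h = B k - c₀) :
    sTransform P (Y s) h = sTransform P ξ h - stieltjesIntegral hγ (Set.Ioc s ⊤)
      fun r => a r * sTransform P (Y r) h + sTransform P (G r) h := by
  have := hX.gaussian.isProbabilityMeasure
  obtain ⟨𝓘, L, V, h𝓘, hL, hV, hY⟩ := hS.equation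
  have hQ0 := sTransform_integrals_eq_zero hX hS.appropriate h𝓘 (c₀ := c₀) (by rwa [hc])
    hS.memL2_Z.1 hts (hV s) hB k
  rw [← hh] at hQ0
  have hQ : MemLp (fun ω => L ((𝓘 ⊤ - 𝓘 s) (Z ω)) + V s ω) 2 P :=
    ((L ∘L (𝓘 ⊤ - 𝓘 s)).comp_memLp' hS.memL2_Z.1).add (hV s).1.1
  have i1 := hX.integrable_wickExp_smul hξ h.2
  have i2 := hX.integrable_wickExp_smul (hS.memL2_Y s).1 h.2
  have i3 := hX.integrable_wickExp_smul hQ h.2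
  have hW : sTransform P (fun ω => stieltjesIntegral hγ (Set.Ioc s ⊤)
      fun r => a r * Y r ω + G r ω) h = sTransform P ξ h - sTransform P (Y s) h := by
    refine Eq.trans ?_ ((congrArg (sTransform P ξ h - sTransform P (Y s) h - ·) hQ0).trans
      (sub_zero _))
    simp only [sTransform]
    rw [← integral_sub i1 i2]
    refine Eq.trans ?_ (integral_sub (i1.sub i2) i3)
    refine integral_congr_ae ?_
    filter_upwards [hY s] with ω hω
    simp only [smul_eq_mul]
    rw [hω]
    ring
  have iY := hS.integrable_prod hcoef.measurable_a h
  have iG := hcoef.integrable_prod h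
  rw [sTransform_stieltjesIntegral hγ _ _ ((iY.add iG).congr (.of_forall fun p => by
    simp only [Pi.add_apply]; ring))] at hW
  -- Additivity is claimed only almost everywhere: integrability of `G_r` against the Wick
  -- exponential comes from Fubini, not for each `r`.
  have hae : (fun r => sTransform P (fun ω => a r * Y r ω + G r ω) h) =ᵐ[totalVar hγ]
      fun r => a r * sTransform P (Y r) h + sTransform P (G r) h := by
    filter_upwards [iG.prod_right_ae] with r hr
    have i4 := (hX.integrable_wickExp_smul (hS.memL2_Y r).1 h.2).const_mul (a r)
    simp only [sTransform, smul_eq_mul] at i4 ⊢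
    rw [← integral_const_mul, ← integral_add i4 hr]
    exact integral_congr_ae (.of_forall fun ω => by ring)
  rw [stieltjesIntegral_congr hγ _ hae] at hW
  rw [hW]
  ring

/-- The `S`-transform of a solvable terminal value, at stopped arguments, is controlled by
the value of the solution at the stopping time. -/
theorem exists_bound_of_isMildSolution (hX : IsCenteredGaussian X P)
    (hcoef : IsAdmissible hX hγ a c G) {c₀ : firstChaos X P}
    (hc : cameronMartinFun X P c₀ = c) {t : TimeInterval T}
    {B : firstChaos X P →L[ℝ] firstChaos X P}
    (hB : ∀ (u : TimeInterval T) (h : firstChaos X P),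
        inner ℝ (hX.val u) (B h : Lp ℝ 2 P) = inner ℝ (hX.val (min u t)) (h : Lp ℝ 2 P))
    {H₀ : Type v} [NormedAddCommGroup H₀] [InnerProductSpace ℝ H₀] [CompleteSpace H₀]
    {ι₀ : TimeInterval T → H₀} {Y₀ : TimeInterval T → Ω → ℝ} {Z₀ : Ω → H₀}
    (hS₀ : IsMildSolution hX hγ a c G 0 ι₀ Y₀ Z₀)
    (hξ : MemLp ξ 2 P) (hS : IsMildSolution hX hγ a c G ξ ι Y Z) :
    ∃ K : ℝ, ∀ k : firstChaos X P,
      |sTransform P ξ (B k - c₀ : firstChaos X P)| ≤ K * Real.exp (‖k - c₀‖ ^ 2 / 2) := by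
  have := nullSingletonClass_totalVar hγ hcoef.continuous_γ
  have ha : Integrable a (totalVar hγ) :=
    ⟨hcoef.measurable_a.aestronglyMeasurable, hcoef.integrable_a⟩
  -- `C` depends on `a`, `γ` and `t` only; its independence of `k` is what makes the final bound
  -- usable.
  obtain ⟨C, hC0, hC⟩ := exists_gronwall_bound ha t
  have hYt := (hS.memL2_Y t).1
  have hYt₀ := (hS₀.memL2_Y t).1
  refine ⟨C * (‖hYt.toLp‖ + ‖hYt₀.toLp‖), fun k => ?_⟩
  set h : firstChaos X P := B k - c₀ with hh
  -- The two solutions may live in different spaces of integrands; they are comparable because the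
  -- `Z`-terms have vanished from both transformed equations.
  let δ : TimeInterval T → ℝ := fun s => sTransform P (Y s) h - sTransform P (Y₀ s) h
  have iY := hS.integrable_sTransform hcoef.measurable_a h
  have iY₀ := hS₀.integrable_sTransform hcoef.measurable_a h
  have iG := hcoef.integrable_sTransform h
  have iδ : Integrable (fun s => a s * δ s) (totalVar hγ) :=
    (iY.sub iY₀).congr (.of_forall fun s => by simp only [Pi.sub_apply, δ]; ring)
  have hδ {s : TimeInterval T} (hts : t ≤ s) :
      δ s = sTransform P ξ h - stieltjesIntegral hγ (Set.Ioc s ⊤) fun r => a r * δ r := by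
    have e1 := hS.sTransform_eq hcoef hξ hc hts hB k hh
    have e2 := hS₀.sTransform_eq hcoef MemLp.zero hc hts hB k hh
    have e3 : sTransform P (0 : Ω → ℝ) (h : Lp ℝ 2 P) = 0 := by simp [sTransform]
    have e4 := stieltjesIntegral_sub hγ (Set.Ioc s ⊤) 
      (f := fun r => a r * sTransform P (Y r) h + sTransform P (G r) h)
      (g := fun r => a r * sTransform P (Y₀ r) h + sTransform P (G r) h)
      (iY.add iG) (iY₀.add iG)
    simp only [add_sub_add_right_eq_sub, ← mul_sub] at e4
    simp only [δ]
    rw [e4, e1, e2, e3]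
    ring
  have hδT : δ ⊤ = sTransform P ξ h := by
    rw [hδ le_top]
    simp [stieltjesIntegral]
  have hδt : |δ ⊤| ≤ C * |δ t| := by
    refine hC δ iδ fun s₁ s₂ h1 h12 => ?_
    rw [hδ h1, hδ (h1.trans h12), ← Set.Ioc_union_Ioc_eq_Ioc h12 le_top,
      stieltjesIntegral_union hγ (Set.Ioc_disjoint_Ioc_of_le le_rfl) measurableSet_Ioc iδ]
    refine le_trans (le_of_eq ?_) (abs_stieltjesIntegral_le hγ (Set.Ioc s₁ s₂) iδ)
    congr 1
    ring
  -- Stopping at `t` changes nothing on `[0, t]`, so `ℱ_t`-measurable variables see `k - c₀` in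
  -- place of `B k - c₀`.
  have heq : ∀ s ≤ t, inner ℝ (hX.val s) (h : Lp ℝ 2 P)
      = inner ℝ (hX.val s) ((k - c₀ : firstChaos X P) : Lp ℝ 2 P) := fun s hs => by
    rw [hh, Submodule.coe_sub, Submodule.coe_sub, inner_sub_right, inner_sub_right, hB,
      min_eq_left hs]
  rw [← hδT]
  refine hδt.trans ?_
  rw [mul_assoc]
  refine mul_le_mul_of_nonneg_left ?_ hC0
  simp only [δ]
  rw [hX.sTransform_congr (hS.adapted_Y t) h.2 (k - c₀).2 heq,
    hX.sTransform_congr (hS₀.adapted_Y t) h.2 (k - c₀).2 heq]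
  refine (abs_sub _ _).trans ?_
  rw [add_mul, mul_comm ‖_‖, mul_comm ‖_‖]
  exact add_le_add (hX.abs_sTransform_le hYt _) (hX.abs_sTransform_le hYt₀ _)

end MildSolution

/-! ### From growth bounds to contractivity of the stopping operator. -/

section Contraction

variable {Ω : Type u} {mΩ : MeasurableSpace Ω} {T : ℝ} [Fact (0 ≤ T)]
  {X : TimeInterval T → Ω → ℝ} {P : Measure Ω}

/-- Adding the bounds for `r` and `-r` cancels the terms linear in `z`; what remains is quadratic in
`r` and bounded above. -/
theorem norm_le_of_forall_norm_sq_sub_le {E : Type*} [NormedAddCommGroup E]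
    [InnerProductSpace ℝ E] {x y z : E} {M : ℝ}
    (H : ∀ r : ℝ, ‖r • x - z‖ ^ 2 - ‖r • y - z‖ ^ 2 ≤ M) : ‖x‖ ≤ ‖y‖ := by
  have key (r : ℝ) : r ^ 2 * (‖x‖ ^ 2 - ‖y‖ ^ 2) ≤ M := by
    have h1 := H r
    have h2 := H (-r)
    simp only [norm_sub_sq_real, norm_smul, inner_smul_left, mul_pow, Real.norm_eq_abs, sq_abs,
      RCLike.conj_to_real] at h1 h2
    nlinarith
  by_contra! hlt
  have hpos : 0 < ‖x‖ ^ 2 - ‖y‖ ^ 2 :=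
    sub_pos.2 (pow_lt_pow_left₀ hlt (norm_nonneg _) two_ne_zero)
  have hM : 0 ≤ M := by simpa using key 0
  have h1 := key √((M + 1) / (‖x‖ ^ 2 - ‖y‖ ^ 2))
  rw [Real.sq_sqrt (by positivity), div_mul_cancel₀ _ hpos.ne'] at h1
  linarith

/-- If the `S`-transform of every element of `L²_X`, composed with an affine map `k ↦ B k - c`,
grows at most as fast as allowed for `k ↦ k - c`, then `B` is a contraction. -/
theorem IsCenteredGaussian.contractive_of_sTransform_bound (hX : IsCenteredGaussian X P)
    (B : firstChaos X P →L[ℝ] firstChaos X P) (c₀ : firstChaos X P)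
    (H : ∀ ξ : Ω → ℝ, hX.MemL2 ⊤ ξ → ∃ K : ℝ, ∀ k : firstChaos X P,
      |sTransform P ξ (B k - c₀ : firstChaos X P)| ≤ K * Real.exp (‖k - c₀‖ ^ 2 / 2))
    (k : firstChaos X P) : ‖B k‖ ≤ ‖k‖ := by
  have : Fact (hX.filtration ⊤ ≤ mΩ) := ⟨hX.filtration.le ⊤⟩
  -- The bound is available only for `ℱ_T`-measurable `ξ`, so uniform boundedness is applied on this
  -- closed subspace. It contains the Wick exponentials, so testing on them still recovers the full
  -- norm.
  let E := lpMeas ℝ ℝ (hX.filtration ⊤) 2 P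
  let g : firstChaos X P → E →L[ℝ] ℝ := fun k =>
    Real.exp (-(‖k - c₀‖ ^ 2 / 2)) • (innerSL ℝ (hX.wick (B k - c₀))) ∘L E.subtypeL
  have hg (k : firstChaos X P) (x : E) : g k x = Real.exp (-(‖k - c₀‖ ^ 2 / 2)) *
      inner ℝ (hX.wick (B k - c₀)) (x : Lp ℝ 2 P) := rfl
  obtain ⟨M, hM⟩ := banach_steinhaus (g := g) fun x => by
    obtain ⟨K, hK⟩ := H (x : Lp ℝ 2 P) ⟨Lp.memLp _, lpMeas.aestronglyMeasurable x⟩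
    refine ⟨K, fun k => ?_⟩
    have h1 := hK k
    rw [hX.sTransform_eq_inner (Lp.memLp _), Lp.toLp_coeFn] at h1
    rw [hg, norm_mul, Real.norm_eq_abs, Real.norm_eq_abs, Real.abs_exp, Real.exp_neg]
    exact (inv_mul_le_iff₀ (Real.exp_pos _)).2 (h1.trans_eq (mul_comm _ _))
  have hexp (k : firstChaos X P) :
      Real.exp (‖B k - c₀‖ ^ 2 / 2 - ‖k - c₀‖ ^ 2 / 2) ≤ M := by
    let x : E := ⟨hX.wick (B k - c₀),
      mem_lpMeas_iff_aestronglyMeasurable.2 (hX.aestronglyMeasurable_wick _)⟩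
    have hx : ‖x‖ = Real.exp (‖B k - c₀‖ ^ 2 / 2) := hX.norm_wick _
    have h1 : g k x ≤ M * ‖x‖ :=
      (le_abs_self _).trans (((g k).le_opNorm x).trans
        (mul_le_mul_of_nonneg_right (hM k) (norm_nonneg _)))
    have h2 : g k x = Real.exp (-(‖k - c₀‖ ^ 2 / 2)) * (‖x‖ * ‖x‖) := by
      rw [hg, ← sq ‖x‖]
      exact congrArg _ (real_inner_self_eq_norm_sq (hX.wick (B k - c₀)))
    rw [h2, ← mul_assoc] at h1
    have h3 := le_of_mul_le_mul_right h1 (hx ▸ Real.exp_pos _)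
    rwa [hx, ← Real.exp_add, neg_add_eq_sub] at h3
  refine norm_le_of_forall_norm_sq_sub_le (z := c₀) (M := 2 * M) fun r => ?_
  -- `x + 1 ≤ exp x` turns the exponential bound into a bound on the difference of squared norms,
  -- uniform in `r`.
  have h1 := (Real.add_one_le_exp _).trans (hexp (r • k))
  rw [map_smul] at h1
  linarith

end Contraction

end GaussianBSDE

open GaussianBSDE
theorem theorem3p3 {Ω : Type u} {mΩ : MeasurableSpace Ω} (P : Measure Ω)
    [IsProbabilityMeasure P] (T : ℝ) [Fact (0 ≤ T)] (X : TimeInterval T → Ω → ℝ)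
    (hX : IsCenteredGaussian X P) (hI : HasIndefiniteWienerIntegral hX)
    (hmart : ¬ Martingale X hX.filtration P)
    (a γ c : TimeInterval T → ℝ) (G : TimeInterval T → Ω → ℝ)
    (hγ : BoundedVariationOn γ Set.univ) (hcoef : IsAdmissible hX hγ a c G) :
    ∃ ξ : Ω → ℝ, hX.MemL2 ⊤ ξ ∧
      ¬ ∃ (H : Type v) (_ : NormedAddCommGroup H) (_ : InnerProductSpace ℝ H)
          (_ : CompleteSpace H) (ι : TimeInterval T → H) (Y : TimeInterval T → Ω → ℝ)
          (Z : Ω → H),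
        IsMildSolution hX hγ a c G ξ ι Y Z := by
  by_contra! hsol
  refine hmart (martingale_of_stopping_contractive hX fun t => ?_)
  obtain ⟨B, hB⟩ := exists_stopping hX hI t
  obtain ⟨c₀, hc₀, hc⟩ := hcoef.mem_cameronMartin
  refine ⟨B, hB, hX.contractive_of_sTransform_bound B ⟨c₀, hc₀⟩ fun ξ hξ => ?_⟩
  -- The solution for `ξ = 0` is the reference that removes the inhomogeneity `G`.
  obtain ⟨H₀, _, _, _, ι₀, Y₀, Z₀, hS₀⟩ := hsol 0 ⟨MemLp.zero, aestronglyMeasurable_zero⟩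
  obtain ⟨H, _, _, _, ι, Y, Z, hS⟩ := hsol ξ hξ
  exact exists_bound_of_isMildSolution hX hcoef hc hB hS₀ hξ.1 hS
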